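/- **Notation.** All graphs are finite, simple and undirected. For an integer $k$, a b-coloring of a graph $G$ with exactly $k$ colors is a mapping $c:V(G)\to\{1,\dots,k\}$ such that adjacent vertices have different colors and such that for every color $i$ there is a vertex of color $i$ that has a neighbour of every color $j\ne i$. The b-chromatic number $b(G)$ is the largest $k$ such that $G$ has a b-coloring with exactly $k$ colors, and $\chi(G)$ is the chromatic number (for the graph without vertices both numbers are $0$). A graph is chordal if every cycle of length at least four has a chord, i.e. an edge between two non-consecutive vertices of the cycle. Let $F_1,\dots,F_{22}$ be the following graphs; $F_i$ has vertex set $\{0,\dots,n-1\}$, and $ab$ stands for the edge $\{a,b\}$. - $F_{1}$: $n=5$; $03, 13, 14, 24$; - $F_{2}$: $n=7$; $04, 14, 25, 36, 56$; - $F_{3}$: $n=9$; $06, 17, 28, 36, 47, 58$; - $F_{4}$: $n=6$; $01, 02, 03, 04, 13, 15, 23, 24, 35$; - $F_{5}$: $n=7$; $02, 03, 05, 13, 14, 25, 34, 35, 36, 46$; - $F_{6}$: $n=8$; $02, 04, 13, 15, 24, 26, 35, 37, 46, 57$; - $F_{7}$: $n=8$; $02, 04, 13, 15, 24, 26, 34,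 35, 37, 46, 57$; - $F_{8}$: $n=8$; $01, 04, 12, 14, 23, 24, 34, 45, 56, 57, 67$; - $F_{9}$: $n=10$; $01, 06, 12, 16, 26, 34, 36, 45, 46, 56, 67, 78, 79, 89$; - $F_{10}$: $n=6$; $01, 02, 04, 13, 15, 23, 24, 25, 35, 45$; - $F_{11}$: $n=7$; $02, 03, 05, 12, 13, 14, 25, 26, 34, 35, 36, 46$; - $F_{12}$: $n=8$; $01, 05, 12, 14, 15, 23, 26, 27, 36, 45, 56, 67$; - $F_{13}$: $n=8$; $01, 04, 05, 12, 14, 16, 23, 25, 27, 36, 37, 45, 56, 67$; - $F_{14}$: $n=8$; $01, 04, 06, 12, 15, 16, 23, 24, 27, 35, 37, 45, 46, 57, 67$; - $F_{15}$: $n=8$; $01, 02, 04, 06, 13, 15, 17, 23, 25, 26, 34, 37, 45, 46, 57, 67$; - $F_{16}$: $n=6$; $01, 02, 13, 24, 25, 34, 35, 45$; - $F_{17}$: $n=6$; $01, 02, 13, 14, 24, 25, 34, 35, 45$; - $F_{18}$: $n=8$; $01, 02, 04, 13, 16, 24, 25, 26, 34, 35, 36, 47, 67$; - $F_{19}$: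 $n=8$; $01, 02, 04, 13, 15, 23, 26, 27, 36, 37, 46, 47, 56, 57$; - $F_{20}$: $n=8$; $01, 03, 04, 12, 16, 23, 24, 25, 36, 37, 45, 47, 56, 67$; - $F_{21}$: $n=8$; $01, 03, 04, 05, 12, 16, 23, 24, 25, 36, 37, 45, 47, 56, 67$; - $F_{22}$: $n=8$; $01, 02, 04, 06, 13, 15, 16, 23, 27, 34, 37, 45, 47, 57, 67$; (So $F_1=P_5$, $F_2=P_4+P_3$ and $F_3=3P_3$.) **Theorem.** Let $G$ be a chordal graph none of whose induced subgraphs is isomorphic to one of $F_1,\dots,F_{22}$. Then $G$ is b-perfect: every induced subgraph $H$ of $G$ satisfies $b(H)=\chi(H)$. -/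

import Mathlib

namespace BPerfect

open SimpleGraph

variable {V : Type*}

/-- A coloring of `G` with color set `Fin k` is a *b-coloring with exactly `k` colors* if every
color `i` has a b-vertex: a vertex of color `i` with a neighbour of every other color.
(In particular all `k` color classes are nonempty.) -/
def IsBColoring {G : SimpleGraph V} {k : ℕ} (c : G.Coloring (Fin k)) : Prop :=
  ∀ i : Fin k, ∃ v, c v = i ∧ ∀ j, j ≠ i → ∃ w, G.Adj v w ∧ c w = j

/-- The b-chromatic number: the largest `k` such that `G` has a b-coloring with exactly `k`
colors. It is taken in `ℕ∞`, like `SimpleGraph.chromaticNumber`. -/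
noncomputable def bChromaticNumber (G : SimpleGraph V) : ℕ∞ :=
  sSup {m : ℕ∞ | ∃ k : ℕ, m = k ∧ ∃ c : G.Coloring (Fin k), IsBColoring c}

/-- In every b-coloring of a finite graph, the number of colors is at most the number of
vertices, so that the supremum above is a maximum. -/
theorem IsBColoring.le_card [Finite V] {G : SimpleGraph V} {k : ℕ} {c : G.Coloring (Fin k)}
    (hc : IsBColoring c) : k ≤ Nat.card V := by
  have hs : Function.Surjective c := fun i => (hc i).imp fun _ h => h.1
  simpa using Nat.card_le_card_of_surjective c hs

/-- `G` is b-perfect if every induced subgraph `H` of `G` satisfies `b(H) = χ(H)`. -/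
def IsBPerfect (G : SimpleGraph V) : Prop :=
  ∀ s : Set V, bChromaticNumber (G.induce s) = (G.induce s).chromaticNumber

/-- `G` is chordal if every cycle of length at least four has a chord: an edge of `G` between
two vertices of the cycle that is not an edge of the cycle. -/
def IsChordal (G : SimpleGraph V) : Prop :=
  ∀ (v : V) (p : G.Walk v v), p.IsCycle → 4 ≤ p.length →
    ∃ x ∈ p.support, ∃ y ∈ p.support, G.Adj x y ∧ s(x, y) ∉ p.edges

/-- The graph on `{0, …, n - 1}` with the listed edges. -/
def ofEdges {n : ℕ} (E : List (Fin n × Fin n)) : SimpleGraph (Fin n) :=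
  SimpleGraph.fromRel fun a b => (a, b) ∈ E

def F1 : SimpleGraph (Fin 5) :=
  ofEdges [(0, 3), (1, 3), (1, 4), (2, 4)]

def F2 : SimpleGraph (Fin 7) :=
  ofEdges [(0, 4), (1, 4), (2, 5), (3, 6), (5, 6)]

def F3 : SimpleGraph (Fin 9) :=
  ofEdges [(0, 6), (1, 7), (2, 8), (3, 6), (4, 7), (5, 8)]

def F4 : SimpleGraph (Fin 6) :=
  ofEdges [(0, 1), (0, 2), (0, 3), (0, 4), (1, 3), (1, 5), (2, 3), (2, 4),
    (3, 5)]

def F5 : SimpleGraph (Fin 7) :=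
  ofEdges [(0, 2), (0, 3), (0, 5), (1, 3), (1, 4), (2, 5), (3, 4), (3, 5),
    (3, 6), (4, 6)]

def F6 : SimpleGraph (Fin 8) :=
  ofEdges [(0, 2), (0, 4), (1, 3), (1, 5), (2, 4), (2, 6), (3, 5), (3, 7),
    (4, 6), (5, 7)]

def F7 : SimpleGraph (Fin 8) :=
  ofEdges [(0, 2), (0, 4), (1, 3), (1, 5), (2, 4), (2, 6), (3, 4), (3, 5),
    (3, 7), (4, 6), (5, 7)]

def F8 : SimpleGraph (Fin 8) :=
  ofEdges [(0, 1), (0, 4), (1, 2), (1, 4), (2, 3), (2, 4), (3, 4), (4, 5),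
    (5, 6), (5, 7), (6, 7)]

def F9 : SimpleGraph (Fin 10) :=
  ofEdges [(0, 1), (0, 6), (1, 2), (1, 6), (2, 6), (3, 4), (3, 6), (4, 5),
    (4, 6), (5, 6), (6, 7), (7, 8), (7, 9), (8, 9)]

def F10 : SimpleGraph (Fin 6) :=
  ofEdges [(0, 1), (0, 2), (0, 4), (1, 3), (1, 5), (2, 3), (2, 4), (2, 5),
    (3, 5), (4, 5)]

def F11 : SimpleGraph (Fin 7) :=
  ofEdges [(0, 2), (0, 3), (0, 5), (1, 2), (1, 3), (1, 4), (2, 5), (2, 6),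
    (3, 4), (3, 5), (3, 6), (4, 6)]

def F12 : SimpleGraph (Fin 8) :=
  ofEdges [(0, 1), (0, 5), (1, 2), (1, 4), (1, 5), (2, 3), (2, 6), (2, 7),
    (3, 6), (4, 5), (5, 6), (6, 7)]

def F13 : SimpleGraph (Fin 8) :=
  ofEdges [(0, 1), (0, 4), (0, 5), (1, 2), (1, 4), (1, 6), (2, 3), (2, 5),
    (2, 7), (3, 6), (3, 7), (4, 5), (5, 6), (6, 7)]

def F14 : SimpleGraph (Fin 8) :=
  ofEdges [(0, 1), (0, 4), (0, 6), (1, 2), (1, 5), (1, 6), (2, 3), (2, 4),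
    (2, 7), (3, 5), (3, 7), (4, 5), (4, 6), (5, 7), (6, 7)]

def F15 : SimpleGraph (Fin 8) :=
  ofEdges [(0, 1), (0, 2), (0, 4), (0, 6), (1, 3), (1, 5), (1, 7), (2, 3),
    (2, 5), (2, 6), (3, 4), (3, 7), (4, 5), (4, 6), (5, 7), (6, 7)]

def F16 : SimpleGraph (Fin 6) :=
  ofEdges [(0, 1), (0, 2), (1, 3), (2, 4), (2, 5), (3, 4), (3, 5), (4, 5)]

def F17 : SimpleGraph (Fin 6) :=
  ofEdges [(0, 1), (0, 2), (1, 3), (1, 4), (2, 4), (2, 5), (3, 4), (3, 5),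
    (4, 5)]

def F18 : SimpleGraph (Fin 8) :=
  ofEdges [(0, 1), (0, 2), (0, 4), (1, 3), (1, 6), (2, 4), (2, 5), (2, 6),
    (3, 4), (3, 5), (3, 6), (4, 7), (6, 7)]

def F19 : SimpleGraph (Fin 8) :=
  ofEdges [(0, 1), (0, 2), (0, 4), (1, 3), (1, 5), (2, 3), (2, 6), (2, 7),
    (3, 6), (3, 7), (4, 6), (4, 7), (5, 6), (5, 7)]

def F20 : SimpleGraph (Fin 8) :=
  ofEdges [(0, 1), (0, 3), (0, 4), (1, 2), (1, 6), (2, 3), (2, 4), (2, 5),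
    (3, 6), (3, 7), (4, 5), (4, 7), (5, 6), (6, 7)]

def F21 : SimpleGraph (Fin 8) :=
  ofEdges [(0, 1), (0, 3), (0, 4), (0, 5), (1, 2), (1, 6), (2, 3), (2, 4),
    (2, 5), (3, 6), (3, 7), (4, 5), (4, 7), (5, 6), (6, 7)]

def F22 : SimpleGraph (Fin 8) :=
  ofEdges [(0, 1), (0, 2), (0, 4), (0, 6), (1, 3), (1, 5), (1, 6), (2, 3),
    (2, 7), (3, 4), (3, 7), (4, 5), (4, 7), (5, 7), (6, 7)]

/-- The class of the twenty-two graphs `F1, …, F22`. -/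
def classF : List (Σ n : ℕ, SimpleGraph (Fin n)) :=
  [⟨_, F1⟩, ⟨_, F2⟩, ⟨_, F3⟩, ⟨_, F4⟩, ⟨_, F5⟩, ⟨_, F6⟩, ⟨_, F7⟩, ⟨_, F8⟩, ⟨_, F9⟩, ⟨_, F10⟩,
    ⟨_, F11⟩, ⟨_, F12⟩, ⟨_, F13⟩, ⟨_, F14⟩, ⟨_, F15⟩, ⟨_, F16⟩, ⟨_, F17⟩, ⟨_, F18⟩, ⟨_, F19⟩,
    ⟨_, F20⟩, ⟨_, F21⟩, ⟨_, F22⟩]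

/-- `G` is `F`-free: no induced subgraph of `G` is (isomorphic to) a member of the class. -/
def IsFFree (G : SimpleGraph V) : Prop :=
  ∀ F ∈ classF, ¬ F.2.IsIndContained G

end BPerfect

namespace BPerfect

set_option linter.unusedSimpArgs false

open SimpleGraph

variable {V : Type*} {G : SimpleGraph V}

/-! ### Forbidden configurations as first-order conditions

Non-adjacency of distinct vertices is expressed by adjacency in `Gᶜ`. -/

/-! The bound b(H) ≤ ω(H) ≤ χ(H) comes from finding a clique with as many vertices as a b-coloring
has colors (`Admissible.hasClique`); conversely, a coloring with χ(H) colors is always a b-coloring.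

For an induction, b-vertices are taken relative to a vertex set X and a color set K, while the
coloring of the whole graph stays fixed. Suppose that each color of K has a b-vertex in X but X has
no clique of size |K|. Then every b-vertex has two non-adjacent neighbours in X. Let U be the clique
of b-vertices adjacent to all other b-vertices. If U is nonempty and each of its members dominates
each b-vertex outside U, then the b-vertices of colors not on U remain b-vertices in the set Y of
common neighbours of U. Induction gives a clique in Y, and adding U completes it.

U is nonempty because non-adjacent b-vertices have a common neighbour (`exists_common_neighbor`),
which by P₅-freeness is again a b-vertex, and the b-vertices induce no P₄ (`not_hasP4_bVertices`): a
connected chordal P₄-free graph has a universal vertex. The domination property is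
`universal_dominates`.

A recurring device: if two anticomplete parts each contain a P₃, then both are free of P₄ and 2P₃.
Such a part has a large clique as soon as it has b-vertices for all colors but one
(`hasClique_of_free`), and if it has no diamond, it has only one possible b-vertex
(`center_unique`). -/

theorem isIndContained_ofEdges {n : ℕ} {E N : List (Fin n × Fin n)} (f : Fin n → V)
    (hlt : ∀ p ∈ E, p.1 < p.2) (hEN : ∀ i j, i < j → (i, j) ∈ E ∨ (i, j) ∈ N)
    (hE : ∀ p ∈ E, G.Adj (f p.1) (f p.2)) (hN : ∀ p ∈ N, Gᶜ.Adj (f p.1) (f p.2)) :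
    (ofEdges E).IsIndContained G := by
  have hne : ∀ i j, i < j → f i ≠ f j := fun i j hij => by
    rcases hEN i j hij with h | h
    · exact (hE _ h).ne
    · exact (hN _ h).ne
  have hadj : ∀ i j, i < j → (G.Adj (f i) (f j) ↔ (ofEdges E).Adj i j) := by
    intro i j hij
    simp only [ofEdges, fromRel_adj]
    constructor
    · intro h
      refine ⟨hij.ne, Or.inl ?_⟩
      rcases hEN i j hij with h' | h'
      · exact h'
      · exact absurd h ((compl_adj _ _ _).1 (hN _ h')).2
    · rintro ⟨-, h | h⟩
      · exact hE _ h
      · exact absurd (hlt _ h) (not_lt.2 hij.le)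
  have hinj : Function.Injective f := by
    intro i j h
    by_contra hij
    rcases lt_or_gt_of_ne hij with hij | hij
    · exact hne i j hij h
    · exact hne j i hij h.symm
  refine ⟨⟨⟨f, hinj⟩, ?_⟩⟩
  intro i j
  rcases lt_trichotomy i j with hij | rfl | hij
  · exact hadj i j hij
  · simp
  · rw [G.adj_comm, (ofEdges E).adj_comm]
    exact hadj j i hij

/-- The middle vertex `a` is adjacent to both of the non-adjacent vertices `p` and `q`. -/
structure IsP3 (G : SimpleGraph V) (p a q : V) : Prop where
  left : G.Adj a p
  right : G.Adj a q
  nadj : Gᶜ.Adj p q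

/-- `a b c d` is an induced path. -/
structure IsP4 (G : SimpleGraph V) (a b c d : V) : Prop where
  ab : G.Adj a b
  bc : G.Adj b c
  cd : G.Adj c d
  ac : Gᶜ.Adj a c
  ad : Gᶜ.Adj a d
  bd : Gᶜ.Adj b d

/-- Adjacency in `Gᶜ` includes distinctness, so the two sets are disjoint. -/
def Anticomplete (G : SimpleGraph V) (A B : Set V) : Prop :=
  ∀ a ∈ A, ∀ b ∈ B, Gᶜ.Adj a b

def HasP3 (G : SimpleGraph V) (A : Set V) : Prop :=
  ∃ p ∈ A, ∃ a ∈ A, ∃ q ∈ A, IsP3 G p a q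

def HasP4 (G : SimpleGraph V) (A : Set V) : Prop :=
  ∃ a ∈ A, ∃ b ∈ A, ∃ c ∈ A, ∃ d ∈ A, IsP4 G a b c d

def HasTwoP3 (G : SimpleGraph V) (A : Set V) : Prop :=
  ∃ B ⊆ A, ∃ C ⊆ A, Anticomplete G B C ∧ HasP3 G B ∧ HasP3 G C

/-- The vertices `a` and `b` are those of degree three. -/
def HasDiamond (G : SimpleGraph V) (A : Set V) : Prop :=
  ∃ a ∈ A, ∃ b ∈ A, ∃ p ∈ A, ∃ q ∈ A, G.Adj a b ∧ IsP3 G p a q ∧ IsP3 G p b q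

/-- The consequences of being chordal and `F`-free on which the proof relies. -/
structure Admissible (G : SimpleGraph V) : Prop where
  c4 : ∀ {a b c d}, G.Adj a b → G.Adj b c → G.Adj c d → G.Adj a d →
    Gᶜ.Adj a c → Gᶜ.Adj b d → False
  /-- No induced path or cycle on five vertices. -/
  p5 : ∀ {a b c d e}, IsP4 G a b c d → G.Adj d e → Gᶜ.Adj b e → Gᶜ.Adj c e → False
  p4_p3 : ∀ {A B}, Anticomplete G A B → HasP4 G A → ¬ HasP3 G B
  twoP3_p3 : ∀ {A B}, Anticomplete G A B → HasTwoP3 G A → ¬ HasP3 G B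
  /-- The square of the path on six vertices. -/
  f4 : ∀ {x' x s s' y y'}, G.Adj x' x → G.Adj x' s → G.Adj x s → G.Adj x s' → G.Adj s s' →
    G.Adj s y → G.Adj s' y → G.Adj s' y' → G.Adj y y' → Gᶜ.Adj x' s' → Gᶜ.Adj x' y →
    Gᶜ.Adj x' y' → Gᶜ.Adj x y → Gᶜ.Adj x y' → Gᶜ.Adj s y' → False
  /-- Two diamonds sharing a vertex `u` of degree two in the first, three in the second. -/
  f5 : ∀ {u t b d x x₁ x₂}, G.Adj b d → IsP3 G u b t → IsP3 G u d t → G.Adj u x →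
    IsP3 G x₁ u x₂ → IsP3 G x₁ x x₂ → Anticomplete G {t, b, d} {x₁, x, x₂} → False
  diamonds : ∀ {A B}, Anticomplete G A B → HasDiamond G A → ¬ HasDiamond G B
  /-- Two diamonds joined by an edge between vertices of degree three. -/
  f7 : ∀ {x p x₁ x₂ y q y₁ y₂}, G.Adj x p → IsP3 G x₁ x x₂ → IsP3 G x₁ p x₂ → G.Adj y q →
    IsP3 G y₁ y y₂ → IsP3 G y₁ q y₂ → G.Adj p q → Anticomplete G {x, x₁, x₂} {y, y₁, y₂} →
    Anticomplete G {p} {y, y₁, y₂} → Anticomplete G {x, x₁, x₂} {q} → False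
  f8 : ∀ {A : Set V} {u b t t'}, G.Adj u b → IsP3 G u b t → IsP3 G u b t' → G.Adj t t' →
    (∀ a ∈ A, G.Adj u a) → Anticomplete G {b, t, t'} A → ¬ HasP4 G A
  f9 : ∀ {A : Set V} {u b t t'}, G.Adj u b → IsP3 G u b t → IsP3 G u b t' → G.Adj t t' →
    (∀ a ∈ A, G.Adj u a) → Anticomplete G {b, t, t'} A → ¬ HasTwoP3 G A

/-! ### Heredity, and the translation of the forbidden graphs -/

theorem IsChordal.comap {W : Type*} {H : SimpleGraph W} (f : H ↪g G) (h : IsChordal G) :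
    IsChordal H := by
  intro v p hp hlen
  obtain ⟨x, hx, y, hy, hxy, he⟩ := h _ (p.map f.toHom) (hp.map f.injective) (by simpa using hlen)
  simp only [Walk.support_map, List.mem_map] at hx hy
  obtain ⟨x, hx, rfl⟩ := hx
  obtain ⟨y, hy, rfl⟩ := hy
  refine ⟨x, hx, y, hy, f.map_adj_iff.1 hxy, fun hmem => he ?_⟩
  rw [Walk.edges_map, List.mem_map]
  exact ⟨_, hmem, by simp⟩

theorem IsFFree.comap {W : Type*} {H : SimpleGraph W} (f : H ↪g G) (h : IsFFree G) :
    IsFFree H := fun F hF hFH => h F hF (hFH.trans ⟨f⟩)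

theorem IsChordal.c4 (h : IsChordal G) {a b c d} (hab : G.Adj a b) (hbc : G.Adj b c)
    (hcd : G.Adj c d) (had : G.Adj a d) (hac : Gᶜ.Adj a c) (hbd : Gᶜ.Adj b d) : False := by
  rw [compl_adj] at hac hbd
  have hp : (Walk.cons hab (.cons hbc (.cons hcd (.cons had.symm .nil)))).IsCycle := by
    simp [Walk.cons_isCycle_iff, hab.ne, hbc.ne, hcd.ne, had.ne, hac.1, hbd.1, hab.ne', hbc.ne',
      hcd.ne', had.ne', hac.1.symm, hbd.1.symm]
  obtain ⟨x, hx, y, hy, hxy, he⟩ := h a _ hp (by simp)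
  simp at hx hy he
  have := hxy.ne
  have := G.adj_comm c a
  have := G.adj_comm d b
  rcases hx with rfl | rfl | rfl | rfl | rfl <;> rcases hy with rfl | rfl | rfl | rfl | rfl <;>
    simp_all

theorem IsChordal.c5 (h : IsChordal G) {a b c d e} (hab : G.Adj a b) (hbc : G.Adj b c)
    (hcd : G.Adj c d) (hde : G.Adj d e) (hae : G.Adj a e) (hac : Gᶜ.Adj a c) (had : Gᶜ.Adj a d)
    (hbd : Gᶜ.Adj b d) (hbe : Gᶜ.Adj b e) (hce : Gᶜ.Adj c e) : False := by
  rw [compl_adj] at hac had hbd hbe hce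
  have hp : (Walk.cons hab (.cons hbc (.cons hcd (.cons hde (.cons hae.symm .nil))))).IsCycle := by
    simp [Walk.cons_isCycle_iff, hab.ne, hbc.ne, hcd.ne, hae.ne, hac.1, hbd.1, hab.ne', hbc.ne',
      hcd.ne', hae.ne', hac.1.symm, hbd.1.symm, had.1, had.1.symm, hbe.1, hbe.1.symm, hce.1,
      hce.1.symm, hde.ne, hde.ne']
  obtain ⟨x, hx, y, hy, hxy, he⟩ := h a _ hp (by simp)
  simp at hx hy he
  have := hxy.ne
  have := G.adj_comm c a
  have := G.adj_comm d b
  have := G.adj_comm d a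
  have := G.adj_comm e b
  have := G.adj_comm e c
  rcases hx with rfl | rfl | rfl | rfl | rfl | rfl <;>
    rcases hy with rfl | rfl | rfl | rfl | rfl | rfl <;> simp_all

theorem IsFFree.f4 (h : IsFFree G) {x' x s s' y y' : V} (h1 : G.Adj x' x) (h2 : G.Adj x' s)
    (h3 : G.Adj x s) (h4 : G.Adj x s') (h5 : G.Adj s s')
    (h6 : G.Adj s y) (h7 : G.Adj s' y) (h8 : G.Adj s' y') (h9 : G.Adj y y') (n1 : Gᶜ.Adj x' s')
    (n2 : Gᶜ.Adj x' y) (n3 : Gᶜ.Adj x' y') (n4 : Gᶜ.Adj x y) (n5 : Gᶜ.Adj x y')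
    (n6 : Gᶜ.Adj s y') : False := by
  refine h ⟨_, F4⟩ (by simp [classF]) (isIndContained_ofEdges
    (N := [(0, 5), (1, 2), (1, 4), (2, 5), (3, 4), (4, 5)])
    ![s, y, x, s', x', y'] (by decide) (by decide) ?_ ?_)
  · simp only [List.forall_mem_cons]
    exact ⟨h6, h3.symm, h5, h2.symm, h7.symm, h9, h4, h1.symm, h8, by simp⟩
  · simp only [List.forall_mem_cons]
    exact ⟨n6, n4.symm, n2.symm, n5, n1.symm, n3, by simp⟩
theorem IsFFree.p5 (h : IsFFree G) {a b c d e : V} (h1 : IsP4 G a b c d) (h2 : G.Adj d e)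
    (h3 : Gᶜ.Adj b e) (h4 : Gᶜ.Adj c e) (hae : Gᶜ.Adj a e) : False := by
  refine h ⟨_, F1⟩ (by simp [classF]) (isIndContained_ofEdges (N := [(0, 1), (0, 2), (0, 4), (1,
    2), (2, 3), (3, 4)])
    ![a, c, e, b, d] (by decide) (by decide) ?_ ?_)
  · simp only [List.forall_mem_cons]
    exact ⟨h1.ab, h1.bc.symm, h1.cd, h2.symm, by simp⟩
  · simp only [List.forall_mem_cons]
    exact ⟨h1.ac, hae, h1.ad, h4, h3.symm, h1.bd, by simp⟩

theorem IsFFree.p4_p3 (h : IsFFree G) {A B : Set V} (hAB : Anticomplete G A B) (hA : HasP4 G A) :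
    ¬ HasP3 G B := by
  rintro ⟨p, hp, x, hx, q, hq, h2⟩
  obtain ⟨a, ha, b, hb, c, hc, d, hd, h1⟩ := hA
  refine h ⟨_, F2⟩ (by simp [classF]) (isIndContained_ofEdges (N := [(0, 1), (0, 2), (0, 3), (0,
    5), (0, 6), (1, 2), (1, 3), (1, 5), (1, 6), (2, 3), (2, 4), (2, 6), (3, 4), (3, 5), (4, 5),
    (4, 6)])
    ![p, q, a, d, x, b, c] (by decide) (by decide) ?_ ?_)
  · simp only [List.forall_mem_cons]
    exact ⟨h2.left.symm, h2.right.symm, h1.ab, h1.cd.symm, h1.bc, by simp⟩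
  · simp only [List.forall_mem_cons]
    exact ⟨h2.nadj, (hAB _ ha _ hp).symm, (hAB _ hd _ hp).symm, (hAB _ hb _ hp).symm, (hAB _ hc
      _ hp).symm, (hAB _ ha _ hq).symm, (hAB _ hd _ hq).symm, (hAB _ hb _ hq).symm, (hAB _ hc _
      hq).symm, h1.ad, hAB _ ha _ hx, h1.ac, hAB _ hd _ hx, h1.bd.symm, (hAB _ hb _ hx).symm, (hAB
      _ hc _ hx).symm, by simp⟩

theorem IsFFree.twoP3_p3 (h : IsFFree G) {A B : Set V} (hAB : Anticomplete G A B)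
    (hA : HasTwoP3 G A) : ¬ HasP3 G B := by
  rintro ⟨p, hp, x, hx, q, hq, h3⟩
  obtain ⟨C, hCA, D, hDA, hCD, ⟨a, ha, b, hb, c, hc, h1⟩, d, hd, e, he, f, hf, h2⟩ := hA
  refine h ⟨_, F3⟩ (by simp [classF]) (isIndContained_ofEdges (N := [(0, 1), (0, 2), (0, 3), (0,
    4), (0, 5), (0, 7), (0, 8), (1, 2), (1, 3), (1, 4), (1, 5), (1, 6), (1, 8), (2, 3), (2, 4),
    (2, 5), (2, 6), (2, 7), (3, 4), (3, 5), (3, 7), (3, 8), (4, 5), (4, 6), (4, 8), (5, 6), (5,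
    7), (6, 7), (6, 8), (7, 8)])
    ![a, d, p, c, f, q, b, e, x] (by decide) (by decide) ?_ ?_)
  · simp only [List.forall_mem_cons]
    exact ⟨h1.left.symm, h2.left.symm, h3.left.symm, h1.right.symm, h2.right.symm,
      h3.right.symm, by simp⟩
  · simp only [List.forall_mem_cons]
    exact ⟨hCD _ ha _ hd, hAB _ (hCA ha) _ hp, h1.nadj, hCD _ ha _ hf, hAB _ (hCA ha) _ hq, hCD
      _ ha _ he, hAB _ (hCA ha) _ hx, hAB _ (hDA hd) _ hp, (hCD _ hc _ hd).symm, h2.nadj, hAB _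
      (hDA hd) _ hq, (hCD _ hb _ hd).symm, hAB _ (hDA hd) _ hx, (hAB _ (hCA hc) _ hp).symm, (hAB _
      (hDA hf) _ hp).symm, h3.nadj, (hAB _ (hCA hb) _ hp).symm, (hAB _ (hDA he) _ hp).symm, hCD _
      hc _ hf, hAB _ (hCA hc) _ hq, hCD _ hc _ he, hAB _ (hCA hc) _ hx, hAB _ (hDA hf) _ hq, (hCD
      _ hb _ hf).symm, hAB _ (hDA hf) _ hx, (hAB _ (hCA hb) _ hq).symm, (hAB _ (hDA he) _
      hq).symm, hCD _ hb _ he, hAB _ (hCA hb) _ hx, hAB _ (hDA he) _ hx, by simp⟩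

theorem IsFFree.f5 (h : IsFFree G) {u t b d x x₁ x₂ : V} (hbd : G.Adj b d) (h1 : IsP3 G u b t)
    (h2 : IsP3 G u d t) (hux : G.Adj u x) (h3 : IsP3 G x₁ u x₂) (h4 : IsP3 G x₁ x x₂)
    (ha : Anticomplete G {t, b, d} {x₁, x, x₂}) : False := by
  refine h ⟨_, F5⟩ (by simp [classF]) (isIndContained_ofEdges (N := [(0, 1), (0, 4), (0, 6), (1,
    2), (1, 5), (1, 6), (2, 3), (2, 4), (2, 6), (4, 5), (5, 6)])
    ![b, x₁, t, u, x, d, x₂] (by decide) (by decide) ?_ ?_)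
  · simp only [List.forall_mem_cons]
    exact ⟨h1.right, h1.left, hbd, h3.left.symm, h4.left.symm, h2.right.symm, hux, h2.left.symm,
      h3.right, h4.right, by simp⟩
  · simp only [List.forall_mem_cons]
    exact ⟨ha _ (by simp) _ (by simp), ha _ (by simp) _ (by simp), ha _ (by simp) _ (by simp),
      (ha _ (by simp) _ (by simp)).symm, (ha _ (by simp) _ (by simp)).symm, h4.nadj, h2.nadj.symm,
      ha _ (by simp) _ (by simp), ha _ (by simp) _ (by simp), (ha _ (by simp) _ (by simp)).symm,
      ha _ (by simp) _ (by simp), by simp⟩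

theorem IsFFree.diamonds (h : IsFFree G) {A B : Set V} (hAB : Anticomplete G A B)
    (hA : HasDiamond G A) : ¬ HasDiamond G B := by
  rintro ⟨d, hd, e, he, x, hx, y, hy, hde, h3, h4⟩
  obtain ⟨a, ha, b, hb, p, hp, q, hq, hab, h1, h2⟩ := hA
  refine h ⟨_, F6⟩ (by simp [classF]) (isIndContained_ofEdges (N := [(0, 1), (0, 3), (0, 5), (0,
    6), (0, 7), (1, 2), (1, 4), (1, 6), (1, 7), (2, 3), (2, 5), (2, 7), (3, 4), (3, 6), (4, 5),
    (4, 7), (5, 6), (6, 7)])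
    ![p, x, a, d, b, e, q, y] (by decide) (by decide) ?_ ?_)
  · simp only [List.forall_mem_cons]
    exact ⟨h1.left.symm, h2.left.symm, h3.left.symm, h4.left.symm, hab, h1.right, hde, h3.right,
      h2.right, h4.right, by simp⟩
  · simp only [List.forall_mem_cons]
    exact ⟨hAB _ hp _ hx, hAB _ hp _ hd, hAB _ hp _ he, h2.nadj, hAB _ hp _ hy, (hAB _ ha _
      hx).symm, (hAB _ hb _ hx).symm, (hAB _ hq _ hx).symm, h4.nadj, hAB _ ha _ hd, hAB _ ha _ he,
      hAB _ ha _ hy, (hAB _ hb _ hd).symm, (hAB _ hq _ hd).symm, hAB _ hb _ he, hAB _ hb _ hy,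
      (hAB _ hq _ he).symm, hAB _ hq _ hy, by simp⟩

theorem IsFFree.f7 (h : IsFFree G) {x p x₁ x₂ y q y₁ y₂ : V} (hxp : G.Adj x p)
    (h1 : IsP3 G x₁ x x₂) (h2 : IsP3 G x₁ p x₂) (hyq : G.Adj y q) (h3 : IsP3 G y₁ y y₂)
    (h4 : IsP3 G y₁ q y₂) (hpq : G.Adj p q) (ha : Anticomplete G {x, x₁, x₂} {y, y₁, y₂})
    (hb : Anticomplete G {p} {y, y₁, y₂}) (hc : Anticomplete G {x, x₁, x₂} {q}) : False := by
  refine h ⟨_, F7⟩ (by simp [classF]) (isIndContained_ofEdges (N := [(0, 1), (0, 3), (0, 5), (0,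
    6), (0, 7), (1, 2), (1, 4), (1, 6), (1, 7), (2, 3), (2, 5), (2, 7), (3, 6), (4, 5), (4, 7),
    (5, 6), (6, 7)])
    ![x₁, y₁, x, q, p, y, x₂, y₂] (by decide) (by decide) ?_ ?_)
  · simp only [List.forall_mem_cons]
    exact ⟨h1.left.symm, h2.left.symm, h4.left.symm, h3.left.symm, hxp, h1.right, hpq.symm,
      hyq.symm, h4.right, h2.right, h3.right, by simp⟩
  · simp only [List.forall_mem_cons]
    exact ⟨ha _ (by simp) _ (by simp), hc _ (by simp) _ (by simp), ha _ (by simp) _ (by simp),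
      h2.nadj, ha _ (by simp) _ (by simp), (ha _ (by simp) _ (by simp)).symm, (hb _ (by simp) _
      (by simp)).symm, (ha _ (by simp) _ (by simp)).symm, h4.nadj, hc _ (by simp) _ (by simp), ha
      _ (by simp) _ (by simp), ha _ (by simp) _ (by simp), (hc _ (by simp) _ (by simp)).symm, hb _
      (by simp) _ (by simp), hb _ (by simp) _ (by simp), (ha _ (by simp) _ (by simp)).symm, ha _
      (by simp) _ (by simp), by simp⟩

theorem IsFFree.f8 (h : IsFFree G) {A : Set V} {u b t t' : V} (hub : G.Adj u b)
    (h1 : IsP3 G u b t) (h2 : IsP3 G u b t') (htt : G.Adj t t') (huA : ∀ a ∈ A, G.Adj u a)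
    (ha : Anticomplete G {b, t, t'} A) : ¬ HasP4 G A := by
  rintro ⟨c, hc, d, hd, e, he, f, hf, h4⟩
  refine h ⟨_, F8⟩ (by simp [classF]) (isIndContained_ofEdges (N := [(0, 2), (0, 3), (0, 5), (0,
    6), (0, 7), (1, 3), (1, 5), (1, 6), (1, 7), (2, 5), (2, 6), (2, 7), (3, 5), (3, 6), (3, 7),
    (4, 6), (4, 7)])
    ![c, d, e, f, u, b, t, t'] (by decide) (by decide) ?_ ?_)
  · simp only [List.forall_mem_cons]
    exact ⟨h4.ab, (huA _ hc).symm, h4.bc, (huA _ hd).symm, h4.cd, (huA _ he).symm, (huA _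
      hf).symm, hub, h1.right, h2.right, htt, by simp⟩
  · simp only [List.forall_mem_cons]
    exact ⟨h4.ac, h4.ad, (ha _ (by simp) _ hc).symm, (ha _ (by simp) _ hc).symm, (ha _ (by simp)
      _ hc).symm, h4.bd, (ha _ (by simp) _ hd).symm, (ha _ (by simp) _ hd).symm, (ha _ (by simp) _
      hd).symm, (ha _ (by simp) _ he).symm, (ha _ (by simp) _ he).symm, (ha _ (by simp) _
      he).symm, (ha _ (by simp) _ hf).symm, (ha _ (by simp) _ hf).symm, (ha _ (by simp) _
      hf).symm, h1.nadj, h2.nadj, by simp⟩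

theorem IsFFree.f9 (h : IsFFree G) {A : Set V} {u b t t' : V} (hub : G.Adj u b)
    (h1 : IsP3 G u b t) (h2 : IsP3 G u b t') (htt : G.Adj t t') (huA : ∀ a ∈ A, G.Adj u a)
    (ha : Anticomplete G {b, t, t'} A) : ¬ HasTwoP3 G A := by
  rintro ⟨B, hB, C, hC, hBC, ⟨c, hc, d, hd, e, he, h4⟩, x, hx, y, hy, z, hz, h5⟩
  refine h ⟨_, F9⟩ (by simp [classF]) (isIndContained_ofEdges (N := [(0, 2), (0, 3), (0, 4), (0,
    5), (0, 7), (0, 8), (0, 9), (1, 3), (1, 4), (1, 5), (1, 7), (1, 8), (1, 9), (2, 3), (2, 4),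
    (2, 5), (2, 7), (2, 8), (2, 9), (3, 5), (3, 7), (3, 8), (3, 9), (4, 7), (4, 8), (4, 9), (5,
    7), (5, 8), (5, 9), (6, 8), (6, 9)])
    ![c, d, e, x, y, z, u, b, t, t'] (by decide) (by decide) ?_ ?_)
  · simp only [List.forall_mem_cons]
    exact ⟨h4.left.symm, (huA _ (hB hc)).symm, h4.right, (huA _ (hB hd)).symm, (huA _ (hB
      he)).symm, h5.left.symm, (huA _ (hC hx)).symm, h5.right, (huA _ (hC hy)).symm, (huA _ (hC
      hz)).symm, hub, h1.right, h2.right, htt, by simp⟩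
  · simp only [List.forall_mem_cons]
    exact ⟨h4.nadj, hBC _ hc _ hx, hBC _ hc _ hy, hBC _ hc _ hz, (ha _ (by simp) _ (hB
      hc)).symm, (ha _ (by simp) _ (hB hc)).symm, (ha _ (by simp) _ (hB hc)).symm, hBC _ hd _ hx,
      hBC _ hd _ hy, hBC _ hd _ hz, (ha _ (by simp) _ (hB hd)).symm, (ha _ (by simp) _ (hB
      hd)).symm, (ha _ (by simp) _ (hB hd)).symm, hBC _ he _ hx, hBC _ he _ hy, hBC _ he _ hz, (ha
      _ (by simp) _ (hB he)).symm, (ha _ (by simp) _ (hB he)).symm, (ha _ (by simp) _ (hB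
      he)).symm, h5.nadj, (ha _ (by simp) _ (hC hx)).symm, (ha _ (by simp) _ (hC hx)).symm, (ha _
      (by simp) _ (hC hx)).symm, (ha _ (by simp) _ (hC hy)).symm, (ha _ (by simp) _ (hC hy)).symm,
      (ha _ (by simp) _ (hC hy)).symm, (ha _ (by simp) _ (hC hz)).symm, (ha _ (by simp) _ (hC
      hz)).symm, (ha _ (by simp) _ (hC hz)).symm, h1.nadj, h2.nadj, by simp⟩

theorem IsFFree.admissible (hf : IsFFree G) (hc : IsChordal G) : Admissible G where
  c4 := hc.c4
  p5 := by
    intro a b c d e h1 h2 h3 h4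
    -- The remaining pair `a`, `e` decides between an induced cycle and an induced path on five
    -- vertices.
    by_cases hae : G.Adj a e
    · exact hc.c5 h1.ab h1.bc h1.cd h2 hae h1.ac h1.ad h1.bd h3 h4
    · refine hf.p5 h1 h2 h3 h4 ((compl_adj _ _ _).2 ⟨?_, hae⟩)
      rintro rfl
      exact ((compl_adj _ _ _).1 h1.ad).2 h2.symm
  p4_p3 := hf.p4_p3
  twoP3_p3 := hf.twoP3_p3
  f4 := hf.f4
  f5 := hf.f5
  diamonds := hf.diamonds
  f7 := hf.f7
  f8 := hf.f8
  f9 := hf.f9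

/-! ### Basic tools -/

theorem not_adj_of_compl {a b : V} (h : Gᶜ.Adj a b) : ¬ G.Adj a b :=
  ((compl_adj _ _ _).1 h).2

theorem compl_adj_of {a b : V} (hne : a ≠ b) (h : ¬ G.Adj a b) : Gᶜ.Adj a b :=
  (compl_adj _ _ _).2 ⟨hne, h⟩

theorem eq_or_adj_or_compl (G : SimpleGraph V) (a b : V) : a = b ∨ G.Adj a b ∨ Gᶜ.Adj a b := by
  by_cases h : a = b
  · exact .inl h
  · by_cases h' : G.Adj a b
    · exact .inr (.inl h')
    · exact .inr (.inr (compl_adj_of h h'))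

/-- An edge between the ends would close an induced four-cycle, so their non-adjacency comes for
free. -/
theorem Admissible.isP4 (hG : Admissible G) {a b c d : V} (hab : G.Adj a b) (hbc : G.Adj b c)
    (hcd : G.Adj c d) (hac : Gᶜ.Adj a c) (hbd : Gᶜ.Adj b d) : IsP4 G a b c d := by
  refine ⟨hab, hbc, hcd, hac, ?_, hbd⟩
  rcases eq_or_adj_or_compl G a d with rfl | h | h
  · exact absurd hcd.symm (not_adj_of_compl hac)
  · exact (hG.c4 hab hbc hcd h hac hbd).elim
  · exact h

theorem IsP4.reverse {a b c d : V} (h : IsP4 G a b c d) : IsP4 G d c b a :=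
  ⟨h.cd.symm, h.bc.symm, h.ab.symm, h.bd.symm, h.ad.symm, h.ac.symm⟩

theorem IsP3.reverse {p a q : V} (h : IsP3 G p a q) : IsP3 G q a p :=
  ⟨h.right, h.left, h.nadj.symm⟩

theorem Anticomplete.symm {A B : Set V} (h : Anticomplete G A B) : Anticomplete G B A :=
  fun b hb a ha => (h a ha b hb).symm

/-- Every neighbour of `x` in `X` is in the closed neighbourhood of `s`. -/
def Dominates (G : SimpleGraph V) (X : Set V) (s x : V) : Prop :=
  ∀ w ∈ X, G.Adj x w → w = s ∨ G.Adj s w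

theorem not_dominates {X : Set V} {s x : V} (h : ¬ Dominates G X s x) :
    ∃ w ∈ X, G.Adj x w ∧ Gᶜ.Adj s w := by
  unfold Dominates at h
  push Not at h
  obtain ⟨w, hw, hxw, hne, hsw⟩ := h
  exact ⟨w, hw, hxw, compl_adj_of hne.symm hsw⟩

theorem Dominates.adj {X : Set V} {s x w : V} (h : Dominates G X s x) (hw : w ∈ X)
    (hxw : G.Adj x w) (hne : w ≠ s) : G.Adj s w :=
  (h w hw hxw).resolve_left hne

/-- The vertex `s` cannot be an end: it would then equal or see the other end. Hence no neighbour of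
`x` that lies in such a P₃ dominates `x`; this is used repeatedly to rule out edges. -/
theorem IsP3.of_dominates {X : Set V} {s x p q : V} (h : IsP3 G p x q) (hd : Dominates G X s x)
    (hp : p ∈ X) (hq : q ∈ X) : IsP3 G p s q := by
  have h1 := hd p hp h.left
  have h2 := hd q hq h.right
  have hn := not_adj_of_compl h.nadj
  refine ⟨h1.resolve_left ?_, h2.resolve_left ?_, h.nadj⟩
  · rintro rfl
    rcases h2 with rfl | h2
    · exact h.nadj.ne rfl
    · exact hn h2
  · rintro rfl
    rcases h1 with rfl | h1
    · exact h.nadj.ne rfl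
    · exact hn h1.symm

/-- `a` has two non-adjacent neighbours in `X`. -/
def IsCenter (G : SimpleGraph V) (X : Set V) (a : V) : Prop :=
  ∃ p ∈ X, ∃ q ∈ X, IsP3 G p a q

theorem IsCenter.hasDiamond {X : Set V} {v d : V} (h : IsCenter G X d) (hv : v ∈ X) (hd : d ∈ X)
    (hvd : G.Adj v d) (hdom : Dominates G X v d) : HasDiamond G X := by
  obtain ⟨p, hp, q, hq, h⟩ := h
  exact ⟨d, hd, v, hv, p, hp, q, hq, hvd.symm, h, h.of_dominates hdom hp hq⟩

theorem anticomplete_diff {X C : Set V} (hcl : ∀ w ∈ C, ∀ z ∈ X, G.Adj w z → z ∈ C) :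
    Anticomplete G C (X \ C) := by
  rintro a ha b ⟨hb, hbC⟩
  refine compl_adj_of ?_ fun h => hbC (hcl a ha b hb h)
  rintro rfl
  exact hbC ha

theorem IsCenter.of_closed {X C : Set V} (hcl : ∀ w ∈ C, ∀ z ∈ X, G.Adj w z → z ∈ C) {a : V}
    (h : IsCenter G X a) (ha : a ∈ C) : IsCenter G C a := by
  obtain ⟨p, hp, q, hq, h⟩ := h
  exact ⟨p, hcl a ha p hp h.left, q, hcl a ha q hq h.right, h⟩

theorem closed_diff {X C : Set V} (hcl : ∀ w ∈ C, ∀ z ∈ X, G.Adj w z → z ∈ C) :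
    ∀ w ∈ X \ C, ∀ z ∈ X, G.Adj w z → z ∈ X \ C :=
  fun w hw z hz h => ⟨hz, fun hzC => hw.2 (hcl z hzC w hw.1 h.symm)⟩

theorem IsCenter.hasP3 {X : Set V} {a : V} (h : IsCenter G X a) (ha : a ∈ X) : HasP3 G X := by
  obtain ⟨p, hp, q, hq, h⟩ := h
  exact ⟨p, hp, a, ha, q, hq, h⟩

theorem hasTwoP3_of_closed {X C : Set V} (hCX : C ⊆ X)
    (hcl : ∀ w ∈ C, ∀ z ∈ X, G.Adj w z → z ∈ C) {a b : V} (ha : IsCenter G X a)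
    (hb : IsCenter G X b) (haC : a ∈ C) (hbX : b ∈ X) (hbC : b ∉ C) : HasTwoP3 G X :=
  ⟨C, hCX, X \ C, Set.sdiff_subset, anticomplete_diff hcl, (ha.of_closed hcl haC).hasP3 haC,
    (hb.of_closed (closed_diff hcl) ⟨hbX, hbC⟩).hasP3 ⟨hbX, hbC⟩⟩

/-- In a `P₄`-free set of vertices, each vertex lies in a component with a universal vertex. -/
theorem Admissible.exists_closed_neighbor [Finite V] (hG : Admissible G) {X : Set V}
    (hP : ¬ HasP4 G X) {d : V} (hd : d ∈ X) :
    ∃ v ∈ X, (d = v ∨ G.Adj v d) ∧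
      ∀ w ∈ X, (w = v ∨ G.Adj v w) → ∀ z ∈ X, G.Adj w z → z = v ∨ G.Adj v z := by
  let N : V → Set V := fun x => {w ∈ X | w = x ∨ G.Adj x w}
  obtain ⟨v, ⟨hvX, hvd⟩, hmax⟩ :=
    -- A vertex with largest closed neighbourhood in `X`, among `d` and its neighbours, is universal
    -- in its component.
    Set.exists_max_image (N d) (fun x => (N x).ncard) (Set.toFinite _) ⟨d, hd, .inl rfl⟩
  have hdv : d = v ∨ G.Adj v d := hvd.imp Eq.symm fun h => h.symm
  refine ⟨v, hvX, hdv, fun w hw hwv z hz hwz => ?_⟩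
  rcases hwv with rfl | hvw
  · exact .inr hwz
  by_contra hzv
  push Not at hzv
  have hvz := compl_adj_of hzv.1.symm hzv.2
  -- Otherwise `y v w z` is an induced P₄; the inclusion is strict because of `z`, against
  -- maximality.
  have hsub : N v ⊆ N w := by
    rintro y ⟨hy, rfl | hvy⟩
    · exact ⟨hy, .inr hvw.symm⟩
    refine ⟨hy, ?_⟩
    rcases eq_or_adj_or_compl G w y with h | h | h
    · exact .inl h.symm
    · exact .inr h
    · exact (hP ⟨y, hy, v, hvX, w, hw, z, hz,
        hG.isP4 hvy.symm hvw hwz h.symm hvz⟩).elim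
  have hwd : w ∈ N d := by
    obtain ⟨-, h⟩ := hsub ⟨hd, hdv⟩
    exact ⟨hw, h.imp Eq.symm fun h => h.symm⟩
  have hlt : (N v).ncard < (N w).ncard := by
    refine Set.ncard_lt_ncard ⟨hsub, fun h => ?_⟩ (Set.toFinite _)
    obtain ⟨-, h⟩ := h (show z ∈ N w from ⟨hz, .inr hwz⟩)
    exact h.elim hzv.1 hzv.2
  exact absurd (hmax w hwd) (not_le.2 hlt)

/-- Centers in different components give 2P₃, and a center other than the universal vertex `v` of
its component forms a diamond with `v`. -/
theorem Admissible.center_unique [Finite V] (hG : Admissible G) {X : Set V} (h4 : ¬ HasP4 G X)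
    (h3 : ¬ HasTwoP3 G X) (hdia : ¬ HasDiamond G X) {a b : V} (ha : a ∈ X) (hb : b ∈ X)
    (haC : IsCenter G X a) (hbC : IsCenter G X b) : a = b := by
  obtain ⟨v, hv, hav, hcl⟩ := hG.exists_closed_neighbor h4 ha
  have key : ∀ y ∈ X, IsCenter G X y → (y = v ∨ G.Adj v y) → y = v := fun y hy hyC hyv =>
    hyv.resolve_right fun h => hdia (hyC.hasDiamond hv hy h fun w hw hyw => hcl y hy hyv w hw hyw)
  have hbv : b = v ∨ G.Adj v b := by
    by_contra hbv
    exact h3 (hasTwoP3_of_closed (C := {w ∈ X | w = v ∨ G.Adj v w}) (fun _ h => h.1)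
      (fun w hw z hz h => ⟨hz, hcl w hw.1 hw.2 z hz h⟩) haC hbC ⟨ha, hav⟩ hb fun h => hbv h.2)
  rw [key a ha haC hav, key b hb hbC hbv]

/-! ### Vertices seeing all colors -/

variable {κ : Type*} {c : G.Coloring κ} {X : Set V} {K : Finset κ}

/-- `v ∈ X` has a neighbour in `X` of every color in `K` other than its own. -/
def IsBVertex (c : G.Coloring κ) (X : Set V) (K : Finset κ) (v : V) : Prop :=
  v ∈ X ∧ ∀ j ∈ K, j ≠ c v → ∃ w ∈ X, G.Adj v w ∧ c w = j

def HasClique (G : SimpleGraph V) (X : Set V) (n : ℕ) : Prop :=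
  ∃ Q : Finset V, ↑Q ⊆ X ∧ G.IsClique ↑Q ∧ n ≤ Q.card

theorem IsBVertex.restrict {Y : Set V} {L : Finset κ} {d : V} (hd : IsBVertex c X K d)
    (hLK : L ⊆ K) (hdY : d ∈ Y) (h : ∀ w ∈ X, G.Adj d w → c w ∈ L → w ∈ Y) :
    IsBVertex c Y L d := by
  refine ⟨hdY, fun j hj hne => ?_⟩
  obtain ⟨w, hw, hdw, rfl⟩ := hd.2 j (hLK hj) hne
  exact ⟨w, h w hw hdw hj, hdw, rfl⟩

theorem IsBVertex.of_dominates {s x : V} (hx : IsBVertex c X K x) (hs : s ∈ X) (hsx : G.Adj s x)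
    (hd : Dominates G X s x) : IsBVertex c X K s := by
  refine ⟨hs, fun j hj hne => ?_⟩
  by_cases hjx : j = c x
  · exact ⟨x, hx.1, hsx, hjx.symm⟩
  · obtain ⟨w, hw, hxw, rfl⟩ := hx.2 j hj hjx
    exact ⟨w, hw, hd.adj hw hxw fun h => hne (h ▸ rfl), rfl⟩

/-- Otherwise the closed neighbourhood of `v` in `X` is a clique that carries all colors of `K`. -/
theorem IsBVertex.isCenter [Finite V] (hno : ¬ HasClique G X K.card) {v : V}
    (hv : IsBVertex c X K v) : IsCenter G X v := by
  classical
  by_contra h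
  refine hno ⟨(Set.toFinite {w ∈ X | w = v ∨ G.Adj v w}).toFinset, ?_, ?_, ?_⟩
  · simp only [Set.Finite.coe_toFinset]
    exact fun w hw => hw.1
  · simp only [Set.Finite.coe_toFinset]
    rintro p ⟨hp, rfl | hvp⟩ q ⟨hq, rfl | hvq⟩ hne
    · exact absurd rfl hne
    · exact hvq
    · exact hvp.symm
    · by_contra hpq
      exact h ⟨p, hp, q, hq, hvp, hvq, compl_adj_of hne hpq⟩
  · refine le_trans (Finset.card_le_card fun j hj => ?_) (Finset.card_image_le (f := c))
    rw [Finset.mem_image]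
    by_cases hjv : j = c v
    · exact ⟨v, by simp [hv.1], hjv.symm⟩
    · obtain ⟨w, hw, hvw, rfl⟩ := hv.2 j hj hjv
      exact ⟨w, by simp [hw, hvw], rfl⟩

open Classical in
/-- The colors of `K` that do not appear on `U`. -/
noncomputable def colorsOff (c : G.Coloring κ) (K : Finset κ) (U : Set V) : Finset κ :=
  K.filter fun i => ∀ u ∈ U, c u ≠ i

theorem mem_colorsOff {U : Set V} {i : κ} :
    i ∈ colorsOff c K U ↔ i ∈ K ∧ ∀ u ∈ U, c u ≠ i := by
  classical
  simp [colorsOff]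

theorem colorsOff_subset {U : Set V} : colorsOff c K U ⊆ K :=
  fun _ h => (mem_colorsOff.1 h).1

/-- The colors of `K` that are removed all occur on `U`, so there are at most as many of them as
vertices in `U`. -/
theorem HasClique.extend [Finite V] {U Y : Set V} (hU : G.IsClique U) (hUX : U ⊆ X) (hYX : Y ⊆ X)
    (hUY : ∀ u ∈ U, ∀ y ∈ Y, G.Adj u y) (h : HasClique G Y (colorsOff c K U).card) :
    HasClique G X K.card := by
  classical
  obtain ⟨Q, hQY, hQ, hcard⟩ := h
  have hUf := Set.toFinite U
  refine ⟨hUf.toFinset ∪ Q, ?_, ?_, ?_⟩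
  · simp only [Finset.coe_union, Set.Finite.coe_toFinset]
    exact Set.union_subset hUX (hQY.trans hYX)
  · simp only [Finset.coe_union, Set.Finite.coe_toFinset]
    rintro a (ha | ha) b (hb | hb) hne
    · exact hU ha hb hne
    · exact hUY a ha b (hQY hb)
    · exact (hUY b hb a (hQY ha)).symm
    · exact hQ ha hb hne
  · have hdisj : Disjoint hUf.toFinset Q := by
      rw [Finset.disjoint_left]
      intro a ha haQ
      exact (hUY a (by simpa using ha) a (hQY haQ)).ne rfl
    rw [Finset.card_union_of_disjoint hdisj]
    have hsub : K ⊆ hUf.toFinset.image c ∪ colorsOff c K U := by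
      intro i hi
      by_cases h : ∀ u ∈ U, c u ≠ i
      · exact Finset.mem_union_right _ (mem_colorsOff.2 ⟨hi, h⟩)
      · push Not at h
        obtain ⟨u, hu, rfl⟩ := h
        exact Finset.mem_union_left _ (Finset.mem_image.2 ⟨u, by simpa using hu, rfl⟩)
    calc K.card ≤ _ := Finset.card_le_card hsub
      _ ≤ _ := Finset.card_union_le _ _
      _ ≤ _ := Nat.add_le_add Finset.card_image_le hcard

/-- In a `{P₄, 2P₃}`-free set, b-vertices for all colors but one yield a large clique. -/
theorem Admissible.hasClique_of_free [Finite V] (hG : Admissible G) (γ : κ) (hX : X.Nonempty)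
    (h4 : ¬ HasP4 G X) (h3 : ¬ HasTwoP3 G X)
    (hb : ∀ i ∈ K, i ≠ γ → ∃ d, IsBVertex c X K d ∧ c d = i) : HasClique G X K.card := by
  classical
  induction X using WellFoundedLT.induction generalizing K with
  | ind X ih =>
  -- With at most the exceptional color left, a single vertex is a large enough clique.
  by_cases hK : ∀ i ∈ K, i = γ
  · obtain ⟨x, hx⟩ := hX
    refine ⟨{x}, by simpa using hx, by simp, ?_⟩
    rw [Finset.card_singleton, Finset.card_le_one]
    intro i hi j hj
    rw [hK i hi, hK j hj]
  push Not at hK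
  obtain ⟨i, hi, hiγ⟩ := hK
  obtain ⟨d, hd, -⟩ := hb i hi hiγ
  by_contra hno
  have hdC := hd.isCenter hno
  obtain ⟨v, hv, hdv, hcl⟩ := hG.exists_closed_neighbor h4 hd.1
  let Y : Set V := {w ∈ X | G.Adj v w}
  have hYX : Y ⊆ X := fun _ h => h.1
  have hvY : v ∉ Y := fun h => h.2.ne rfl
  refine hno (HasClique.extend (U := {v}) (Y := Y) (c := c) (by simp) (by simpa using hv) hYX ?_ ?_)
  · rintro u rfl y hy
    exact hy.2
  refine ih Y ⟨hYX, fun h => hvY (h hv)⟩ ?_ ?_ ?_ ?_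
  · rcases hdv with rfl | hdv
    · obtain ⟨p, hp, q, hq, h⟩ := hdC
      exact ⟨p, hp, h.left⟩
    · exact ⟨d, hd.1, hdv⟩
  · rintro ⟨a, ha, b, hb, e, he, f, hf, h⟩
    exact h4 ⟨a, hYX ha, b, hYX hb, e, hYX he, f, hYX hf, h⟩
  · rintro ⟨B, hB, C, hC, h⟩
    exact h3 ⟨B, hB.trans hYX, C, hC.trans hYX, h⟩
  · intro j hj hjγ
    obtain ⟨hjK, hjv⟩ := mem_colorsOff.1 hj
    obtain ⟨e, he, rfl⟩ := hb j hjK hjγ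
    -- All b-vertices are centers, so a second component containing one would create 2P₃.
    have hev : e = v ∨ G.Adj v e := by
      by_contra hev
      exact h3 (hasTwoP3_of_closed (C := {w ∈ X | w = v ∨ G.Adj v w}) (fun _ h => h.1)
        (fun w hw z hz h => ⟨hz, hcl w hw.1 hw.2 z hz h⟩) hdC (he.isCenter hno) ⟨hd.1, hdv⟩ he.1
        fun h => hev h.2)
    have hne : e ≠ v := by
      rintro rfl
      exact hjv e rfl rfl
    refine ⟨e, he.restrict colorsOff_subset ⟨he.1, hev.resolve_left hne⟩ fun w hw hew hcw => ?_, rfl⟩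
    refine ⟨hw, (hcl e he.1 hev w hw hew).resolve_left ?_⟩
    rintro rfl
    exact (mem_colorsOff.1 hcw).2 w rfl rfl

/-! ### The graph of b-vertices -/

/-- At distance three, the ends of a path `x p q y` are dominated by `p` and `q`, which yields two
diamonds joined by `pq`. At larger distance, `x` and `y` lie in different components; each side must
contain a diamond, since otherwise it holds b-vertices of only one color and the other side has a
large clique. -/
theorem Admissible.exists_common_neighbor [Finite V] (hG : Admissible G)
    (hb : ∀ i ∈ K, ∃ d, IsBVertex c X K d ∧ c d = i) (hno : ¬ HasClique G X K.card) {x y : V}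
    (hx : IsBVertex c X K x) (hy : IsBVertex c X K y) (hxy : Gᶜ.Adj x y) :
    ∃ s ∈ X, G.Adj x s ∧ G.Adj y s := by
  by_contra! hcom
  have hcom' : ∀ {s}, s ∈ X → G.Adj x s → Gᶜ.Adj s y := fun {s} hs h =>
    compl_adj_of (by rintro rfl; exact not_adj_of_compl hxy h) fun h' => hcom s hs h h'.symm
  have hcom'' : ∀ {s}, s ∈ X → G.Adj y s → Gᶜ.Adj x s := fun {s} hs h =>
    compl_adj_of (by rintro rfl; exact not_adj_of_compl hxy h.symm) fun h' => hcom s hs h' h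
  have hxC := hx.isCenter hno
  have hyC := hy.isCenter hno
  by_cases hpath : ∃ p ∈ X, ∃ q ∈ X, G.Adj x p ∧ G.Adj p q ∧ G.Adj q y
  · obtain ⟨p, hp, q, hq, hxp, hpq, hqy⟩ := hpath
    have hdx : ∀ {p q}, p ∈ X → q ∈ X → G.Adj x p → G.Adj p q → G.Adj q y →
        Dominates G X p x := by
      intro p q hp hq hxp hpq hqy
      by_contra h
      obtain ⟨w, hw, hxw, hpw⟩ := not_dominates h
      exact hG.p5 (hG.isP4 hxw.symm hxp hpq hpw.symm (hcom'' hq hqy.symm)) hqy hxy (hcom' hp hxp)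
    have hdy : ∀ {p q}, p ∈ X → q ∈ X → G.Adj x p → G.Adj p q → G.Adj q y →
        Dominates G X q y := by
      intro p q hp hq hxp hpq hqy
      by_contra h
      obtain ⟨w, hw, hyw, hqw⟩ := not_dominates h
      exact hG.p5 (hG.isP4 hyw.symm hqy.symm hpq.symm hqw.symm (hcom' hp hxp).symm) hxp.symm
        hxy.symm (hcom'' hq hqy.symm).symm
    obtain ⟨x₁, hx₁, x₂, hx₂, h1⟩ := hxC
    obtain ⟨y₁, hy₁, y₂, hy₂, h2⟩ := hyC
    have h1' := h1.of_dominates (hdx hp hq hxp hpq hqy) hx₁ hx₂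
    have h2' := h2.of_dominates (hdy hp hq hxp hpq hqy) hy₁ hy₂
    have hxq : ∀ {z z'}, z ∈ X → z' ∈ X → IsP3 G z x z' → Gᶜ.Adj z q := by
      intro z z' hz hz' h
      refine compl_adj_of ?_ fun hzq => ?_
      · rintro rfl
        exact not_adj_of_compl (hcom' hz h.left) hqy
      · exact ((h.of_dominates (hdx hz hq h.left hzq hqy) hz hz').left).ne rfl
    have hyp : ∀ {z z'}, z ∈ X → z' ∈ X → IsP3 G z y z' → Gᶜ.Adj p z := by
      intro z z' hz hz' h
      refine compl_adj_of ?_ fun hpz => ?_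
      · rintro rfl
        exact not_adj_of_compl (hcom' hz hxp) h.left.symm
      · exact ((h.of_dominates (hdy hp hz hxp hpz h.left.symm) hz hz').left).ne rfl
    have hcross : ∀ {z z' w w'}, z ∈ X → z' ∈ X → IsP3 G z x z' → w ∈ X → w' ∈ X →
        IsP3 G w y w' → G.Adj z p → G.Adj w q → Gᶜ.Adj z w :=
      fun hz hz' h hw hw' h' hzp hwq =>
        (hG.isP4 hzp hpq hwq.symm (hxq hz hz' h) (hyp hw hw' h')).ad
    refine hG.f7 hxp h1 h1' hqy.symm h2 h2' hpq ?_ ?_ ?_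
    · have a1 := hcross hx₁ hx₂ h1 hy₁ hy₂ h2 h1'.left.symm h2'.left.symm
      have a2 := hcross hx₁ hx₂ h1 hy₂ hy₁ h2.reverse h1'.left.symm h2'.right.symm
      have a3 := hcross hx₂ hx₁ h1.reverse hy₁ hy₂ h2 h1'.right.symm h2'.left.symm
      have a4 := hcross hx₂ hx₁ h1.reverse hy₂ hy₁ h2.reverse h1'.right.symm h2'.right.symm
      rintro a (rfl | rfl | rfl) b (rfl | rfl | rfl)
      · exact hxy
      · exact hcom'' hy₁ h2.left
      · exact hcom'' hy₂ h2.right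
      · exact hcom' hx₁ h1.left
      · exact a1
      · exact a2
      · exact hcom' hx₂ h1.right
      · exact a3
      · exact a4
    · rintro a rfl b (rfl | rfl | rfl)
      · exact hcom' hp hxp
      · exact hyp hy₁ hy₂ h2
      · exact hyp hy₂ hy₁ h2.reverse
    · rintro a (rfl | rfl | rfl) b rfl
      · exact hcom'' hq hqy.symm
      · exact hxq hx₁ hx₂ h1
      · exact hxq hx₂ hx₁ h1.reverse
  -- The ball of radius three around `x` in `X`. It is a union of components because a vertex just
  -- outside would end an induced P₅.
  · let C : Set V := {w ∈ X | w = x ∨ G.Adj x w ∨ (∃ p ∈ X, G.Adj x p ∧ G.Adj p w) ∨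
      ∃ p ∈ X, ∃ q ∈ X, G.Adj x p ∧ G.Adj p q ∧ G.Adj q w}
    have hCX : C ⊆ X := fun _ h => h.1
    have hcl : ∀ w ∈ C, ∀ z ∈ X, G.Adj w z → z ∈ C := by
      rintro w ⟨hw, h⟩ z hz hwz
      by_contra hzC
      have hzC' : ¬ _ := fun h => hzC ⟨hz, h⟩
      push Not at hzC'
      obtain ⟨n1, n2, n3, n4⟩ := hzC'
      rcases h with rfl | h | ⟨p, hp, hxp, hpw⟩ | ⟨p, hp, q, hq, hxp, hpq, hqw⟩
      · exact n2 hwz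
      · exact n3 w hw h hwz
      · exact n4 p hp w hw hxp hpw hwz
      · have e1 : Gᶜ.Adj x q := by
          rcases eq_or_adj_or_compl G x q with rfl | h | h
          · exact (n3 w hw hqw hwz).elim
          · exact (n4 q hq w hw h hqw hwz).elim
          · exact h
        have e2 : Gᶜ.Adj p w := by
          rcases eq_or_adj_or_compl G p w with rfl | h | h
          · exact (n3 p hp hxp hwz).elim
          · exact (n4 p hp w hw hxp h hwz).elim
          · exact h
        refine hG.p5 (hG.isP4 hxp hpq hqw e1 e2) hwz ?_ ?_
        · rcases eq_or_adj_or_compl G p z with rfl | h | h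
          · exact (n2 hxp).elim
          · exact (n3 p hp hxp h).elim
          · exact h
        · rcases eq_or_adj_or_compl G q z with rfl | h | h
          · exact (n3 p hp hxp hpq).elim
          · exact (n4 p hp q hq hxp hpq h).elim
          · exact h
    have hxCmem : x ∈ C := ⟨hx.1, .inl rfl⟩
    have hyCmem : y ∉ C := by
      rintro ⟨-, rfl | h | ⟨p, hp, h, h'⟩ | ⟨p, hp, q, hq, h⟩⟩
      · exact hxy.ne rfl
      · exact not_adj_of_compl hxy h
      · exact hcom p hp h h'.symm
      · exact hpath ⟨p, hp, q, hq, h⟩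
    have key : ∀ {C : Set V} {x y : V}, C ⊆ X → (∀ w ∈ C, ∀ z ∈ X, G.Adj w z → z ∈ C) →
        IsBVertex c X K x → IsBVertex c X K y → x ∈ C → y ∉ C → HasDiamond G (X \ C) := by
      intro C x y hCX hcl hx hy hxC hyC
      by_contra hdia
      have hanti := anticomplete_diff hcl
      have hcl' := closed_diff hcl
      have hP3 := ((hx.isCenter hno).of_closed hcl hxC).hasP3 hxC
      have hP3' := ((hy.isCenter hno).of_closed hcl' ⟨hy.1, hyC⟩).hasP3 ⟨hy.1, hyC⟩
      have h4 : ¬ HasP4 G C := fun h => hG.p4_p3 hanti h hP3'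
      have h3 : ¬ HasTwoP3 G C := fun h => hG.twoP3_p3 hanti h hP3'
      have h4' : ¬ HasP4 G (X \ C) := fun h => hG.p4_p3 hanti.symm h hP3
      have h3' : ¬ HasTwoP3 G (X \ C) := fun h => hG.twoP3_p3 hanti.symm h hP3
      obtain ⟨Q, hQ, h⟩ : HasClique G C K.card := by
        refine hG.hasClique_of_free (c := c) (c y) ⟨x, hxC⟩ h4 h3 fun i hi hne => ?_
        obtain ⟨d, hd, rfl⟩ := hb i hi
        have hdC : d ∈ C := by
          by_contra hdC
          refine hne ?_
          rw [hG.center_unique h4' h3' hdia ⟨hd.1, hdC⟩ ⟨hy.1, hyC⟩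
            ((hd.isCenter hno).of_closed hcl' ⟨hd.1, hdC⟩)
            ((hy.isCenter hno).of_closed hcl' ⟨hy.1, hyC⟩)]
        exact ⟨d, hd.restrict (Finset.Subset.refl _) hdC fun w hw hdw _ => hcl d hdC w hw hdw, rfl⟩
      exact hno ⟨Q, hQ.trans hCX, h⟩
    refine hG.diamonds (anticomplete_diff hcl) ?_ (key hCX hcl hx hy hxCmem hyCmem)
    have := key Set.sdiff_subset (closed_diff hcl) hy hx ⟨hy.1, hyCmem⟩ fun h => h.2 hxCmem
    rwa [Set.sdiff_sdiff_cancel_left hCX] at this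

/-- Private neighbours `x'` and `y'` would give the forbidden five-vertex configuration `x' x s y
y'`. -/
theorem Admissible.dominates_or_dominates (hG : Admissible G) {x y s : V} (hxy : Gᶜ.Adj x y)
    (hxs : G.Adj x s) (hys : G.Adj y s) : Dominates G X s x ∨ Dominates G X s y := by
  by_contra! h
  obtain ⟨x', -, hx', hsx'⟩ := not_dominates h.1
  obtain ⟨y', -, hy', hsy'⟩ := not_dominates h.2
  exact hG.p5 (hG.isP4 hx'.symm hxs hys.symm hsx'.symm hxy) hy'
    (hG.isP4 hxs hys.symm hy' hxy hsy').ad hsy'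

/-- If `s` dominates `x` but not `y`, then every common neighbour dominates `x`. -/
theorem Admissible.dominates_of_not_dominates (hG : Admissible G) {x y s s' : V}
    (hxy : Gᶜ.Adj x y) (hxs : G.Adj x s) (hys : G.Adj y s) (hxs' : G.Adj x s')
    (hys' : G.Adj y s') (hs'X : s' ∈ X) (hsy : ¬ Dominates G X s y) : Dominates G X s' x := by
  by_contra h
  have hsx := (hG.dominates_or_dominates (X := X) hxy hxs hys).resolve_right hsy
  have hs'y := (hG.dominates_or_dominates (X := X) hxy hxs' hys').resolve_left h
  obtain ⟨x', hx', hxx', hsx'⟩ := not_dominates h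
  obtain ⟨y', hy', hyy', hsy'⟩ := not_dominates hsy
  have hss' : s ≠ s' := by
    rintro rfl
    exact h hsx
  have hx's : G.Adj s x' := by
    refine hsx.adj hx' hxx' ?_
    rintro rfl
    have := hsx s' hs'X hxs'
    rcases this with rfl | this
    · exact hss' rfl
    · exact not_adj_of_compl hsx' this.symm
  have hy's' : G.Adj s' y' := by
    rcases hs'y y' hy' hyy' with rfl | h
    · rcases hsx y' hs'X hxs' with rfl | h
      · exact (hss' rfl).elim
      · exact (not_adj_of_compl hsy' h).elim
    · exact h
  have e1 : Gᶜ.Adj x' y := (hG.isP4 hxx'.symm hxs' hys'.symm hsx'.symm hxy).ad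
  have e2 : Gᶜ.Adj x y' := (hG.isP4 hxs hys.symm hyy' hxy hsy').ad
  have hadj : G.Adj s s' := (hsx s' hs'X hxs').resolve_left hss'.symm
  exact hG.f4 hxx'.symm hx's.symm hxs hxs' hadj hys.symm hys'.symm hy's' hyy' hsx'.symm e1
    (hG.isP4 hx's.symm hadj hy's' hsx'.symm hsy').ad hxy e2 hsy'

/-- Each end of the path is dominated by its neighbour on the path, so two non-adjacent neighbours
of the end complete a diamond. The diamonds at the two ends are joined by the middle edge, which is
the configuration `f7`. -/
theorem Admissible.not_hasP4_bVertices [Finite V] (hG : Admissible G)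
    (hno : ¬ HasClique G X K.card) : ¬ HasP4 G {d | IsBVertex c X K d} := by
  rintro ⟨d₁, h₁, d₂, h₂, d₃, h₃, d₄, h₄, hP⟩
  have half : ∀ {d₁ d₂ d₃ d₄ : V}, IsBVertex c X K d₁ → IsBVertex c X K d₂ → IsBVertex c X K d₃ →
      IsBVertex c X K d₄ → IsP4 G d₁ d₂ d₃ d₄ → ∃ u ∈ X, ∃ v ∈ X, IsP3 G u d₁ v ∧ IsP3 G u d₂ v ∧
        (Gᶜ.Adj u d₃ ∧ Gᶜ.Adj v d₃) ∧ Gᶜ.Adj u d₄ ∧ Gᶜ.Adj v d₄ := by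
    intro d₁ d₂ d₃ d₄ h₁ h₂ h₃ h₄ hP
    have n24 : ¬ Dominates G X d₂ d₃ := fun h =>
      (h d₄ h₄.1 hP.cd).elim (fun h => hP.bd.ne h.symm) (not_adj_of_compl hP.bd)
    have hd21 : Dominates G X d₂ d₁ :=
      (hG.dominates_or_dominates hP.ac hP.ab hP.bc.symm).resolve_right n24
    have hs1 : ∀ s ∈ X, G.Adj d₁ s → G.Adj d₄ s → Dominates G X s d₁ := by
      intro s hs hs1 hs4
      have hs2 : G.Adj d₂ s := by
        refine hd21.adj hs hs1 ?_
        rintro rfl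
        exact not_adj_of_compl hP.bd hs4.symm
      have hs3 : G.Adj d₃ s := by
        rcases eq_or_adj_or_compl G d₃ s with rfl | h | h
        · exact (not_adj_of_compl hP.ac hs1).elim
        · exact h
        · exact (hG.c4 hs2 hs4.symm hP.cd.symm hP.bc hP.bd h.symm).elim
      exact hG.dominates_of_not_dominates hP.ac hP.ab hP.bc.symm hs1 hs3 hs n24
    have hs13 : ∀ s ∈ X, G.Adj d₁ s → G.Adj d₃ s → Dominates G X s d₁ := fun s hs hs1 hs3 =>
      hG.dominates_of_not_dominates hP.ac hP.ab hP.bc.symm hs1 hs3 hs n24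
    obtain ⟨u, hu, v, hv, huv⟩ := h₁.isCenter hno
    -- A neighbour shared with `d₃` or `d₄` would dominate `d₁`, which no end of a P₃ centered at
    -- `d₁` can do.
    have key : ∀ {u v}, u ∈ X → v ∈ X → IsP3 G u d₁ v → Gᶜ.Adj u d₃ ∧ Gᶜ.Adj u d₄ := by
      intro u v hu hv huv
      constructor
      · refine compl_adj_of ?_ fun h => ?_
        · rintro rfl
          exact not_adj_of_compl hP.ac huv.left
        · exact (huv.of_dominates (hs13 u hu huv.left h.symm) hu hv).left.ne rfl
      · refine compl_adj_of ?_ fun h => ?_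
        · rintro rfl
          exact not_adj_of_compl hP.ad huv.left
        · exact (huv.of_dominates (hs1 u hu huv.left h.symm) hu hv).left.ne rfl
    have k1 := key hu hv huv
    have k2 := key hv hu huv.reverse
    exact ⟨u, hu, v, hv, huv, huv.of_dominates hd21 hu hv, ⟨k1.1, k2.1⟩, k1.2, k2.2⟩
  obtain ⟨u₁, hu₁, u₂, hu₂, a1, a2, ⟨a3, a4⟩, a5, a6⟩ := half h₁ h₂ h₃ h₄ hP
  obtain ⟨v₁, hv₁, v₂, hv₂, b1, b2, ⟨b3, b4⟩, b5, b6⟩ := half h₄ h₃ h₂ h₁ hP.reverse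
  refine hG.f7 hP.ab a1 a2 hP.cd.symm b1 b2 hP.bc ?_ ?_ ?_
  · rintro a (rfl | rfl | rfl) b (rfl | rfl | rfl)
    · exact hP.ad
    · exact b5.symm
    · exact b6.symm
    · exact a5
    · exact (hG.isP4 a2.left.symm hP.bc b2.left a3 b3.symm).ad
    · exact (hG.isP4 a2.left.symm hP.bc b2.right a3 b4.symm).ad
    · exact a6
    · exact (hG.isP4 a2.right.symm hP.bc b2.left a4 b3.symm).ad
    · exact (hG.isP4 a2.right.symm hP.bc b2.right a4 b4.symm).ad
  · rintro a rfl b (rfl | rfl | rfl)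
    · exact hP.bd
    · exact b3.symm
    · exact b4.symm
  · rintro a (rfl | rfl | rfl) b rfl
    · exact hP.ac
    · exact a3
    · exact a4

/-! ### Universal b-vertices and their domination property -/

theorem Anticomplete.mono {A A' B B' : Set V} (h : Anticomplete G A B) (hA : A' ⊆ A)
    (hB : B' ⊆ B) : Anticomplete G A' B' :=
  fun a ha b hb => h a (hA ha) b (hB hb)

theorem HasP4.mono {A B : Set V} (hAB : A ⊆ B) : HasP4 G A → HasP4 G B := by
  rintro ⟨a, ha, b, hb, e, he, f, hf, h⟩
  exact ⟨a, hAB ha, b, hAB hb, e, hAB he, f, hAB hf, h⟩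

theorem HasTwoP3.mono {A B : Set V} (hAB : A ⊆ B) : HasTwoP3 G A → HasTwoP3 G B := by
  rintro ⟨C, hC, D, hD, h⟩
  exact ⟨C, hC.trans hAB, D, hD.trans hAB, h⟩

/-- The b-vertices adjacent to all other b-vertices. -/
def universalBVertices (c : G.Coloring κ) (X : Set V) (K : Finset κ) : Set V :=
  {u | IsBVertex c X K u ∧ ∀ d, IsBVertex c X K d → d = u ∨ G.Adj u d}

theorem isClique_universalBVertices : G.IsClique (universalBVertices c X K) :=
  fun _ hu w hw hne => (hu.2 w hw.1).resolve_left hne.symm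

theorem Admissible.isBVertex_of_common_neighbor (hG : Admissible G) {x y s : V}
    (hx : IsBVertex c X K x) (hy : IsBVertex c X K y) (hxy : Gᶜ.Adj x y) (hs : s ∈ X)
    (hxs : G.Adj x s) (hys : G.Adj y s) : IsBVertex c X K s :=
  (hG.dominates_or_dominates (X := X) hxy hxs hys).elim (hx.of_dominates hs hxs.symm)
    (hy.of_dominates hs hys.symm)

theorem Admissible.universalBVertices_nonempty [Finite V] (hG : Admissible G)
    (hb : ∀ i ∈ K, ∃ d, IsBVertex c X K d ∧ c d = i) (hno : ¬ HasClique G X K.card) :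
    (universalBVertices c X K).Nonempty := by
  have hK : K.Nonempty := by
    rw [Finset.nonempty_iff_ne_empty]
    rintro rfl
    -- For empty `K`, the empty clique would suffice.
    exact hno ⟨∅, by simp, by simp, by simp⟩
  obtain ⟨i, hi⟩ := hK
  obtain ⟨d, hd, -⟩ := hb i hi
  obtain ⟨v, hv, -, hcl⟩ :=
    hG.exists_closed_neighbor (hG.not_hasP4_bVertices hno) (show d ∈ {d | IsBVertex c X K d} from hd)
  refine ⟨v, hv, fun y hy => ?_⟩
  rcases eq_or_adj_or_compl G v y with h | h | h
  · exact .inl h.symm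
  · exact .inr h
  · obtain ⟨s, hs, hvs, hys⟩ := hG.exists_common_neighbor hb hno hv hy h
    exact hcl s (hG.isBVertex_of_common_neighbor hv hy h hs hvs hys) (.inr hvs) y hy hys.symm

/-- Universal b-vertices dominate all other b-vertices. -/
theorem Admissible.universal_dominates [Finite V] (hG : Admissible G)
    (hb : ∀ i ∈ K, ∃ d, IsBVertex c X K d ∧ c d = i) (hno : ¬ HasClique G X K.card) {u b : V}
    (hu : u ∈ universalBVertices c X K) (hbD : IsBVertex c X K b)
    (hbU : b ∉ universalBVertices c X K) : Dominates G X u b := by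
  classical
  by_contra hub
  obtain ⟨t, ht, hbt, hut⟩ := not_dominates hub
  set U := universalBVertices c X K with hUdef
  have hUcl : G.IsClique U := isClique_universalBVertices
  have hUX : U ⊆ X := fun s hs => hs.1.1
  have hUadj : ∀ {s d}, s ∈ U → IsBVertex c X K d → d ∉ U → G.Adj s d := fun {s d} hs hd hdU =>
    (hs.2 d hd).resolve_left fun h => hdU (h ▸ hs)
  let D : Set V := {d | IsBVertex c X K d} \ U
  have hDP4 : ¬ HasP4 G D := fun h => hG.not_hasP4_bVertices hno (h.mono Set.sdiff_subset)
  obtain ⟨v, hv, hbv, hcl⟩ := hG.exists_closed_neighbor hDP4 (show b ∈ D from ⟨hbD, hbU⟩)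
  -- The component of `b` among the non-universal b-vertices; `v` is universal in it. The rest `D₂`
  -- is nonempty, as otherwise `v` would belong to `U`.
  let D₁ : Set V := {d ∈ D | d = v ∨ G.Adj v d}
  let D₂ : Set V := D \ D₁
  have hD₁ : ∀ {d}, d ∈ D₁ → IsBVertex c X K d := fun h => h.1.1
  have hD₂ : ∀ {d}, d ∈ D₂ → IsBVertex c X K d := fun h => h.1.1
  have hbD₁ : b ∈ D₁ := ⟨⟨hbD, hbU⟩, hbv⟩
  have hcl₁ : ∀ w ∈ D₁, ∀ z ∈ D, G.Adj w z → z ∈ D₁ := fun w hw z hz h =>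
    ⟨hz, hcl w hw.1 hw.2 z hz h⟩
  have hsep : Anticomplete G D₁ D₂ := anticomplete_diff hcl₁
  have hcommon : ∀ {d x s}, d ∈ D₁ → x ∈ D₂ → s ∈ X → G.Adj d s → G.Adj x s → s ∈ U := by
    intro d x s hd hx hs hds hxs
    by_contra hsU
    have hsD := hG.isBVertex_of_common_neighbor (hD₁ hd) (hD₂ hx) (hsep d hd x hx) hs hds hxs
    exact hx.2 (hcl₁ s (hcl₁ d hd s ⟨hsD, hsU⟩ hds) x hx.1 hxs.symm)
  have hdomU : ∀ {x s}, x ∈ D₂ → s ∈ U → Dominates G X s x := fun {x s} hx hs =>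
    hG.dominates_of_not_dominates (hsep b hbD₁ x hx).symm (hUadj hu (hD₂ hx) hx.1.2).symm
      (hUadj hu hbD hbU).symm (hUadj hs (hD₂ hx) hx.1.2).symm (hUadj hs hbD hbU).symm
      (hUX hs) hub
  obtain ⟨x, hx⟩ : D₂.Nonempty := by
    have hvU : ¬ ∀ d, IsBVertex c X K d → d = v ∨ G.Adj v d := fun h => hv.2 ⟨hv.1, h⟩
    push Not at hvU
    obtain ⟨d, hd, hdv, hvd⟩ := hvU
    refine ⟨d, ⟨hd, fun hdU => ?_⟩, fun h => h.2.elim hdv hvd⟩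
    exact hvd (hUadj hdU hv.1 hv.2).symm
  -- Outside `U`, the sets `B` and `H` are the closed neighbourhoods of `b` and of `D₂`. `U` is
  -- complete to `H`, and `B` is anticomplete to `H`.
  let B : Set V := {w ∈ X | (w = b ∨ G.Adj b w) ∧ w ∉ U}
  let H : Set V := {w ∈ X | w ∉ U ∧ ∃ x ∈ D₂, w = x ∨ G.Adj x w}
  have htU : t ∉ U := fun htU => not_adj_of_compl hut (hUcl hu htU hut.ne)
  have hUb : ∀ {s}, s ∈ U → G.Adj s b := fun hs => hUadj hs hbD hbU
  have hbB : b ∈ B := ⟨hbD.1, .inl rfl, hbU⟩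
  have htB : t ∈ B := ⟨ht, .inr hbt, htU⟩
  have hUH : ∀ {s q}, s ∈ U → q ∈ H → G.Adj s q := by
    rintro s q hs ⟨hq, hqU, x, hx, rfl | hxq⟩
    · exact hUadj hs (hD₂ hx) hx.1.2
    · exact (hdomU hx hs).adj hq hxq fun h => hqU (h ▸ hs)
  have hanti : Anticomplete G B H := by
    have hbH : ∀ q ∈ H, Gᶜ.Adj b q := by
      rintro q ⟨hq, hqU, x, hx, rfl | hxq⟩
      · exact hsep b hbD₁ q hx
      · refine compl_adj_of ?_ fun h => hqU (hcommon hbD₁ hx hq h hxq)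
        rintro rfl
        exact not_adj_of_compl (hsep b hbD₁ x hx) hxq.symm
    have hBD₂ : ∀ p ∈ B, ∀ x ∈ D₂, Gᶜ.Adj p x := by
      rintro p ⟨hp, rfl | hbp, hpU⟩ x hx
      · exact hsep p hbD₁ x hx
      · refine compl_adj_of ?_ fun h => hpU (hcommon hbD₁ hx hp hbp h.symm)
        rintro rfl
        exact not_adj_of_compl (hsep b hbD₁ p hx) hbp
    have hfar : ∀ p ∈ B, Gᶜ.Adj u p → ∀ q ∈ H, Gᶜ.Adj p q := by
      rintro p ⟨hp, rfl | hbp, hpU⟩ hup q hq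
      · exact hbH q hq
      · exact (hG.isP4 hbp.symm (hUb hu).symm (hUH hu hq) hup.symm (hbH q hq)).ad
    intro p hp q hq
    by_cases hpb : p = b
    · exact hpb ▸ hbH q hq
    have hbp : G.Adj b p := hp.2.1.resolve_left hpb
    obtain ⟨hqX, hqU, x, hx, rfl | hxq⟩ := id hq
    · exact hBD₂ p hp q hx
    rcases eq_or_adj_or_compl G p q with rfl | hpq | h
    · exact (hqU (hcommon hbD₁ hx hqX hbp hxq)).elim
    swap
    · exact h
    exfalso
    rcases eq_or_adj_or_compl G t p with rfl | htp | htp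
    · exact not_adj_of_compl (hfar t hp hut q hq) hpq
    · by_cases hqx : Dominates G X q x
      · have hqD := (hD₂ hx).of_dominates hqX hxq.symm hqx
        have hqD₂ : q ∈ D₂ := ⟨⟨hqD, hqU⟩, fun h => hx.2 (hcl₁ q h x hx.1 hxq.symm)⟩
        exact hp.2.2 (hcommon hbD₁ hqD₂ hp.1 hbp hpq.symm)
      · obtain ⟨x₂, -, hxx₂, hqx₂⟩ := not_dominates hqx
        have hpx := hBD₂ p hp x hx
        -- The path `t p q x x₂`.
        exact hG.p5 (hG.isP4 htp hpq hxq.symm (hfar t htB hut q hq) hpx) hxx₂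
          (hG.isP4 hpq hxq.symm hxx₂ hpx hqx₂).ad hqx₂
    · exact hG.p5 (hG.isP4 hbt.symm hbp hpq htp (hbH q hq)) hxq.symm (hbH x ⟨(hD₂ hx).1, hx.1.2,
        x, hx, .inl rfl⟩) (hBD₂ p hp x hx)
  have hD₂H : D₂ ⊆ H := fun x hx => ⟨(hD₂ hx).1, hx.1.2, x, hx, .inl rfl⟩
  have hnotU : ∀ {p d q s}, IsP3 G p d q → p ∈ X → q ∈ X → s ∈ U → Dominates G X s d → p ≠ s := by
    rintro p d q s h hp hq - hd rfl
    exact (h.of_dominates hd hp hq).left.ne rfl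
  have hHc : ∀ {x}, x ∈ D₂ → IsCenter G H x := by
    intro x hx
    obtain ⟨p, hp, q, hq, h⟩ := (hD₂ hx).isCenter hno
    exact ⟨p, ⟨hp, fun hs => hnotU h hp hq hs (hdomU hx hs) rfl, x, hx, .inr h.left⟩,
      q, ⟨hq, fun hs => hnotU h.reverse hq hp hs (hdomU hx hs) rfl, x, hx, .inr h.right⟩, h⟩
  have hHP3 : HasP3 G H := (hHc hx).hasP3 (hD₂H hx)
  obtain ⟨x₁, hx₁, x₂, hx₂, hP3⟩ := hHc hx
  have hxH := hD₂H hx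
  have hP3H : ({x₁, x, x₂} : Set V) ⊆ H := by
    rintro z (rfl | rfl | rfl) <;> assumption
  have hF5 : ∀ {s t' d}, s ∈ U → t' ∈ B → d ∈ B → G.Adj b d → IsP3 G s b t' → IsP3 G s d t' →
      False := by
    intro s t' d hs ht' hd hbd h1 h2
    refine hG.f5 hbd h1 h2 (hUH hs hxH)
      (hP3.of_dominates (hdomU hx hs) hx₁.1 hx₂.1) hP3 (hanti.mono ?_ hP3H)
    rintro z (rfl | rfl | rfl) <;> assumption
  -- If `b` is alone in `D₁`, then `D₂` supplies b-vertices for all colors off `U` except possibly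
  -- that of `b`.
  have hfinish : (∀ d ∈ D₁, d = b) → ¬ HasP4 G H → ¬ HasTwoP3 G H → False := by
    intro hD₁b h4 h3
    refine hno (HasClique.extend (c := c) hUcl hUX (fun _ h => h.1 : H ⊆ X)
      (fun s hs q hq => hUH hs hq) ?_)
    refine hG.hasClique_of_free (c := c) (c b) ⟨x, hxH⟩ h4 h3 fun i hi hib => ?_
    obtain ⟨hiK, hiU⟩ := mem_colorsOff.1 hi
    obtain ⟨d, hd, rfl⟩ := hb i hiK
    have hdU : d ∉ U := fun h => hiU d h rfl
    have hdD₂ : d ∈ D₂ := ⟨⟨hd, hdU⟩, fun h => hib (by rw [hD₁b d h])⟩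
    exact ⟨d, hd.restrict colorsOff_subset (hD₂H hdD₂) fun w hw hdw hcw =>
      ⟨hw, fun h => (mem_colorsOff.1 hcw).2 w h rfl, d, hdD₂, .inr hdw⟩, rfl⟩
  have hnbr : ∀ {d}, d ∈ D₁ → G.Adj b d →
      Gᶜ.Adj t d ∧ Dominates G X b d ∧ ∀ s ∈ U, Dominates G X s d := by
    intro d hd hbd
    have hdB : d ∈ B := ⟨(hD₁ hd).1, .inr hbd, hd.1.2⟩
    have hud : G.Adj u d := hUadj hu (hD₁ hd) hd.1.2
    have htd : Gᶜ.Adj t d := by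
      refine compl_adj_of ?_ fun h => ?_
      · rintro rfl
        exact not_adj_of_compl hut hud
      · exact hF5 hu htB hdB hbd ⟨(hUb hu).symm, hbt, hut⟩ ⟨hud.symm, h.symm, hut⟩
    have hdom : Dominates G X b d := by
      by_contra h
      obtain ⟨d', -, hdd', hbd'⟩ := not_dominates h
      have hP := hG.isP4 hbt.symm hbd hdd' htd hbd'
      have hd'H : ∀ q ∈ H, Gᶜ.Adj d' q := by
        intro q hq
        refine compl_adj_of ?_ fun h => ?_
        · rintro rfl
          exact not_adj_of_compl (hanti d hdB d' hq) hdd'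
        · exact hG.p5 hP h (hanti b hbB q hq) (hanti d hdB q hq)
      refine hG.p4_p3 (A := {t, b, d, d'}) (B := H) ?_
        ⟨t, by simp, b, by simp, d, by simp, d', by simp, hP⟩ hHP3
      rintro z (rfl | rfl | rfl | rfl) q hq
      · exact hanti z htB q hq
      · exact hanti z hbB q hq
      · exact hanti z hdB q hq
      · exact hd'H q hq
    refine ⟨htd, hdom, fun s hs => ?_⟩
    by_contra h
    obtain ⟨d', hd'X, hdd', hsd'⟩ := not_dominates h
    have hd'U : d' ∉ U := fun h => not_adj_of_compl hsd' (hUcl hs h hsd'.ne)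
    have hbd' : G.Adj b d' := by
      refine hdom.adj hd'X hdd' ?_
      rintro rfl
      exact not_adj_of_compl hsd' (hUb hs)
    exact hF5 hs ⟨hd'X, .inr hbd', hd'U⟩ hdB hbd ⟨(hUb hs).symm, hbd', hsd'⟩
      ⟨(hUadj hs (hD₁ hd) hd.1.2).symm, hdd', hsd'⟩
  have hbD₁adj : ∀ {d}, d ∈ D₁ → d ≠ b → G.Adj b d := by
    intro d hd hdb
    rcases hbv with rfl | hbv
    · exact hd.2.resolve_left hdb
    · rcases hd.2 with rfl | hvd
      · exact hbv.symm
      · exact (hnbr ⟨hv, .inl rfl⟩ hbv.symm).2.1.adj (hD₁ hd).1 hvd hdb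
  by_cases hD₁b : ∀ d ∈ D₁, d = b
  · by_cases hex : ∃ t' ∈ X, G.Adj b t' ∧ t' ∉ U ∧ t' ≠ t
    · obtain ⟨t', ht', hbt', ht'U, hne⟩ := hex
      have ht'B : t' ∈ B := ⟨ht', .inr hbt', ht'U⟩
      rcases eq_or_adj_or_compl G t t' with h | htt' | h
      · exact hne h.symm
      · have hut' : Gᶜ.Adj u t' := by
          refine compl_adj_of (fun h => ht'U (h ▸ hu)) fun h => ?_
          exact hF5 hu htB ht'B hbt' ⟨(hUb hu).symm, hbt, hut⟩ ⟨h.symm, htt'.symm, hut⟩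
        have hsub : ({b, t, t'} : Set V) ⊆ B := by
          rintro z (rfl | rfl | rfl) <;> assumption
        have h1 : IsP3 G u b t := ⟨(hUb hu).symm, hbt, hut⟩
        have h2 : IsP3 G u b t' := ⟨(hUb hu).symm, hbt', hut'⟩
        have huH : ∀ a ∈ H, G.Adj u a := fun a ha => hUH hu ha
        have ha := hanti.mono hsub (Set.Subset.refl H)
        exact hfinish hD₁b (hG.f8 (hUb hu) h1 h2 htt' huH ha) (hG.f9 (hUb hu) h1 h2 htt' huH ha)
      · have hBP3 : HasP3 G B := ⟨t, htB, b, hbB, t', ht'B, hbt, hbt', h⟩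
        exact hfinish hD₁b (fun h => hG.p4_p3 hanti.symm h hBP3)
          fun h => hG.twoP3_p3 hanti.symm h hBP3
    · push Not at hex
      -- Now only the colors of `b` and `t` can be missing from `U`, so an edge in `H` is enough.
      refine hno (HasClique.extend (c := c) (Y := {x, x₁}) hUcl hUX ?_ ?_ ?_)
      · rintro z (rfl | rfl)
        · exact hxH.1
        · exact hx₁.1
      · rintro s hs z (rfl | rfl)
        · exact hUH hs hxH
        · exact hUH hs hx₁
      · refine ⟨{x, x₁}, by simp, ?_, ?_⟩
        · simp only [Finset.coe_insert, Finset.coe_singleton, isClique_pair]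
          exact fun _ => hP3.left
        · rw [Finset.card_pair hP3.left.ne]
          refine le_trans (Finset.card_le_card (t := {c b, c t}) fun j hj => ?_) Finset.card_le_two
          obtain ⟨hjK, hjU⟩ := mem_colorsOff.1 hj
          by_cases hjb : j = c b
          · simp [hjb]
          · obtain ⟨w, hw, hbw, rfl⟩ := hbD.2 j hjK hjb
            rw [hex w hw hbw fun h => hjU w h rfl]
            simp
  · push Not at hD₁b
    obtain ⟨d, hd, hdb⟩ := hD₁b
    have hbd := hbD₁adj hd hdb
    obtain ⟨htd, hbdom, hUdom⟩ := hnbr hd hbd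
    have hdB : d ∈ B := ⟨(hD₁ hd).1, .inr hbd, hd.1.2⟩
    have hBP3 : HasP3 G B := ⟨t, htB, b, hbB, d, hdB, hbt, hbd, htd⟩
    obtain ⟨p, hp, q, hq, hpdq⟩ := (hD₁ hd).isCenter hno
    have hpbq := hpdq.of_dominates hbdom hp hq
    have hdia : HasDiamond G B := ⟨b, hbB, d, hdB,
      p, ⟨hp, .inr hpbq.left, fun hs => hnotU hpdq hp hq hs (hUdom p hs) rfl⟩,
      q, ⟨hq, .inr hpbq.right, fun hs => hnotU hpdq.reverse hq hp hs (hUdom q hs) rfl⟩,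
      hbd, hpbq, hpdq⟩
    -- The diamond in `B` excludes diamonds from `H`, so `x` is the only center there. All other
    -- colors off `U` have their b-vertices in `D₁`, and the clique is found among the common
    -- neighbours of `U` and `b`.
    have hD₂x : ∀ y ∈ D₂, y = x := fun y hy =>
      hG.center_unique (fun h => hG.p4_p3 hanti.symm h hBP3)
        (fun h => hG.twoP3_p3 hanti.symm h hBP3) (hG.diamonds hanti hdia) (hD₂H hy) hxH
        (hHc hy) (hHc hx)
    let Y : Set V := {w ∈ X | G.Adj b w ∧ ∀ s ∈ U, G.Adj s w}
    have hYB : Y ⊆ B := fun w hw => ⟨hw.1, .inr hw.2.1, fun h => (hw.2.2 w h).ne rfl⟩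
    refine hno (HasClique.extend (c := c) (U := insert b U) (Y := Y) ?_
      (Set.insert_subset hbD.1 hUX) (fun _ h => h.1) ?_ ?_)
    · exact hUcl.insert fun s hs _ => (hUb hs).symm
    · rintro s (rfl | hs) w hw
      · exact hw.2.1
      · exact hw.2.2 s hs
    · refine hG.hasClique_of_free (c := c) (c x)
        ⟨p, hp, hpbq.left, fun s hs => (hpdq.of_dominates (hUdom s hs) hp hq).left⟩
        (fun h => hG.p4_p3 hanti (h.mono hYB) hHP3)
        (fun h => hG.twoP3_p3 hanti (h.mono hYB) hHP3) fun i hi hix => ?_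
      obtain ⟨hiK, hiU⟩ := mem_colorsOff.1 hi
      obtain ⟨e, he, rfl⟩ := hb i hiK
      have heU : e ∉ U := fun h => hiU e (.inr h) rfl
      have heb : e ≠ b := fun h => hiU b (.inl rfl) (h ▸ rfl)
      have heD₁ : e ∈ D₁ := by
        by_contra h
        exact hix (by rw [hD₂x e ⟨⟨he, heU⟩, h⟩])
      have hbe := hbD₁adj heD₁ heb
      obtain ⟨-, hbdome, hUdome⟩ := hnbr heD₁ hbe
      refine ⟨e, he.restrict colorsOff_subset ⟨he.1, hbe, fun s hs => hUadj hs he heU⟩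
        fun w hw hew hcw => ?_, rfl⟩
      have hcw' := (mem_colorsOff.1 hcw).2
      exact ⟨hw, hbdome.adj hw hew fun h => hcw' b (.inl rfl) (h ▸ rfl),
        fun s hs => (hUdome s hs).adj hw hew fun h => hcw' s (.inr hs) (h ▸ rfl)⟩

/-- If each of the colors in `K` has a b-vertex, then there is a clique of size `K.card`. -/
theorem Admissible.hasClique [Finite V] (hG : Admissible G)
    (hb : ∀ i ∈ K, ∃ d, IsBVertex c X K d ∧ c d = i) : HasClique G X K.card := by
  induction X using WellFoundedLT.induction generalizing K with
  | ind X ih =>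
  by_contra hno
  obtain ⟨u, hu⟩ := hG.universalBVertices_nonempty hb hno
  let Y : Set V := {w ∈ X | ∀ s ∈ universalBVertices c X K, G.Adj s w}
  have hYX : Y ⊆ X := fun _ h => h.1
  refine hno (HasClique.extend (c := c) isClique_universalBVertices (fun s hs => hs.1.1) hYX
    (fun s hs w hw => hw.2 s hs) (ih Y ⟨hYX, fun h => ((h hu.1.1).2 u hu).ne rfl⟩ fun i hi => ?_))
  obtain ⟨hiK, hiU⟩ := mem_colorsOff.1 hi
  obtain ⟨d, hd, rfl⟩ := hb i hiK
  have hdU : d ∉ universalBVertices c X K := fun h => hiU d h rfl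
  refine ⟨d, hd.restrict colorsOff_subset ⟨hd.1, fun s hs => ?_⟩ fun w hw hdw hcw => ?_, rfl⟩
  · exact (hs.2 d hd).resolve_left fun h => hdU (h ▸ hs)
  · exact ⟨hw, fun s hs => (hG.universal_dominates hb hno hs hd hdU).adj hw hdw
      fun h => (mem_colorsOff.1 hcw).2 s hs (h ▸ rfl)⟩

/-! ### Optimal colorings and the theorem -/

/-- A coloring with `χ(G)` colors is a b-coloring. -/
theorem isBColoring_of_chromaticNumber_eq {n : ℕ} (hn : G.chromaticNumber = n)
    (f : G.Coloring (Fin n)) : IsBColoring f := by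
  by_contra h
  unfold IsBColoring at h
  push Not at h
  obtain ⟨i, hi⟩ := h
  -- If color `i` has no b-vertex, each vertex of color `i` can move to a color absent from its
  -- neighbourhood. These vertices are pairwise non-adjacent, so all can move at once and one color
  -- is saved.
  have hch : ∀ v : V, ∃ j : {j : Fin n // j ≠ i},
      (f v ≠ i ∧ f v = j) ∨ (f v = i ∧ ∀ w, G.Adj v w → f w ≠ j) := by
    intro v
    by_cases hv : f v = i
    · obtain ⟨j, hj, h⟩ := hi v hv
      exact ⟨⟨j, hj⟩, .inr ⟨hv, h⟩⟩
    · exact ⟨⟨f v, hv⟩, .inl ⟨hv, rfl⟩⟩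
  choose g hg using hch
  have hgcol : ∀ {v w}, G.Adj v w → g v ≠ g w := by
    intro v w hvw heq
    have hf : f v ≠ f w := f.valid hvw
    rcases hg v with ⟨h1, h2⟩ | ⟨h1, h2⟩ <;> rcases hg w with ⟨h3, h4⟩ | ⟨h3, h4⟩
    · exact hf (by rw [h2, h4, heq])
    · exact h4 v hvw.symm (by rw [h2, heq])
    · exact h2 w hvw (by rw [h4, heq])
    · exact hf (h1.trans h3.symm)
  have hcol := (Coloring.mk g hgcol).colorable.chromaticNumber_le
  rw [hn, Nat.cast_le] at hcol
  simp at hcol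
  have := i.pos
  omega

theorem Admissible.bChromaticNumber_eq [Finite V] (hG : Admissible G) :
    bChromaticNumber G = G.chromaticNumber := by
  refine le_antisymm (sSup_le ?_) ?_
  · rintro _ ⟨k, rfl, f, hf⟩
    obtain ⟨Q, -, hQ, hcard⟩ := hG.hasClique (c := f) (X := Set.univ) (K := Finset.univ)
      fun i _ => by
        obtain ⟨v, rfl, hv⟩ := hf i
        refine ⟨v, ⟨Set.mem_univ v, fun j _ hj => ?_⟩, rfl⟩
        obtain ⟨w, hvw, hw⟩ := hv j hj
        exact ⟨w, Set.mem_univ w, hvw, hw⟩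
    rw [Finset.card_univ, Fintype.card_fin] at hcard
    exact (Nat.cast_le.2 hcard).trans hQ.card_le_chromaticNumber
  · obtain ⟨m, hm⟩ : ∃ m, G.Colorable m := by
      have := Fintype.ofFinite V
      exact ⟨_, G.colorable_of_fintype⟩
    obtain ⟨n, hn⟩ := ENat.ne_top_iff_exists.1 (chromaticNumber_ne_top_iff_exists.2 ⟨m, hm⟩)
    have hcol : G.Colorable n := chromaticNumber_le_iff_colorable.1 hn.symm.le
    obtain ⟨f⟩ := hcol
    rw [← hn]
    exact le_sSup ⟨n, rfl, f, isBColoring_of_chromaticNumber_eq hn.symm f⟩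

end BPerfect

theorem theorem1 {V : Type*} [Finite V] (G : SimpleGraph V)
    (hchordal : BPerfect.IsChordal G) (hfree : BPerfect.IsFFree G) :
    BPerfect.IsBPerfect G := fun s =>
  ((hfree.comap (SimpleGraph.Embedding.induce s)).admissible
    (hchordal.comap (SimpleGraph.Embedding.induce s))).bChromaticNumber_eq
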